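/- A *Luzin gap* is a family $\{A_\alpha\}_{\alpha<\omega_1}$ of infinite subsets of $\mathbb N$ such that $A_\alpha\cap A_\beta$ is finite whenever $\alpha\ne\beta$, and such that for every $\alpha<\omega_1$ and $m\in\mathbb N$ the set $\{\beta<\alpha : A_\alpha\cap A_\beta\subseteq\{0,\dots,m-1\}\}$ is finite. Let $\ell_\infty(\mathbb N,M_2)$ be the $C^*$-algebra of bounded sequences of complex $2\times 2$ matrices, $c_0(\mathbb N,M_2)$ the ideal of sequences converging to $0$ in norm, and $Q\colon \ell_\infty(\mathbb N,M_2)\to\mathcal C=\ell_\infty(\mathbb N,M_2)/c_0(\mathbb N,M_2)$ the quotient map. For $A\subseteq\mathbb N$ put $x_A=\sum_{n\in A}2\cdot 3^{-(n+1)}\in[0,1]$ and let $w_A\in\ell_\infty(\mathbb N,M_2)$ be given by $(w_A)_n=\begin{pmatrix}1&0\\ x_A&-1\end{pmatrix}$ if $n\in A$ and $(w_A)_n=I$ otherwise. **Theorem.** There is a nonseparable amenable operator algebra $\mathcal A$ (a norm-closed subalgebra of some $\mathcal B(H)$, amenable as a Banach algebra) such that no nonseparable subalgebra $\mathcal B\subseteq\mathcal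 A$ (unital or not, and including $\mathcal A$ itself) is isomorphic, as a Banach algebra, to a $C^*$-algebra. More precisely, Luzin gaps exist, and for every Luzin gap $\{A_\alpha\}_{\alpha<\omega_1}$, with $G=\bigoplus_{\alpha<\omega_1}\mathbb Z/2\mathbb Z$ and $e_\alpha$ the generator of its $\alpha$-th summand, the following holds. There is a uniformly bounded representation $\pi\colon G\to\mathcal C$ (that is, $\pi(gh)=\pi(g)\pi(h)$ and $\pi(g)$ is invertible for all $g,h\in G$, and $\sup_{g}\|\pi(g)\|<\infty$) with $\pi(e_\alpha)=Q(w_{A_\alpha})$ for all $\alpha$, and $\mathcal A=Q^{-1}(\overline{\mathrm{span}}\,\pi(G))\subseteq\ell_\infty(\mathbb N,M_2)$ is an algebra with all of the above properties. -/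

import Mathlib

open Filter Topology
open scoped ENNReal Matrix.Norms.L2Operator

noncomputable section

universe u

/-! ### Banach algebras: amenability, operator algebras, isomorphism with a C⋆-algebra -/

/-- Amenability (B. E. Johnson) of a complex Banach algebra `A`, which need not have a unit: for
every Banach `A`-bimodule `X`, every continuous derivation from `A` to the dual bimodule of `X` is
inner. The bimodule actions are the bounded bilinear maps `L a x = a · x` and `R a x = x · a`, and
the actions on the dual are `(a · f) x = f (x · a)` and `(f · a) x = f (a · x)`. -/
def IsAmenableBanachAlgebra (A : Type u) [NonUnitalNormedRing A] [NormedSpace ℂ A] : Prop :=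
  ∀ (X : Type u) [NormedAddCommGroup X] [NormedSpace ℂ X] [CompleteSpace X]
    (L R : A →L[ℂ] X →L[ℂ] X),
    (∀ a b x, L (a * b) x = L a (L b x)) →
    (∀ a b x, R (a * b) x = R b (R a x)) →
    (∀ a b x, L a (R b x) = R b (L a x)) →
    ∀ D : A →L[ℂ] StrongDual ℂ X,
      (∀ a b x, D (a * b) x = D b (R a x) + D a (L b x)) →
      ∃ φ : StrongDual ℂ X, ∀ a x, D a x = φ (R a x) - φ (L a x)

/-- `A` is an operator algebra: it is complete, and isometrically isomorphic, as an algebra, to a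
(then automatically closed) subalgebra of the bounded operators on a complex Hilbert space. -/
def IsOperatorAlgebra (A : Type u) [NonUnitalNormedRing A] [NormedSpace ℂ A] : Prop :=
  CompleteSpace A ∧
    ∃ (H : Type u) (_ : NormedAddCommGroup H) (_ : InnerProductSpace ℂ H) (_ : CompleteSpace H)
      (φ : A →ₙₐ[ℂ] (H →L[ℂ] H)), Isometry φ

/-- `B` is isomorphic, as a Banach algebra, to a (not necessarily unital) C⋆-algebra: there is a
multiplicative linear homeomorphism onto one. As such a C⋆-algebra is in bijection with `B`, it is
no restriction that it lives in the universe of `B`. -/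
def IsIsomorphicToCStarAlgebra (B : Type u) [NonUnitalNormedRing B] [NormedSpace ℂ B] : Prop :=
  ∃ (D : Type u) (_ : NonUnitalCStarAlgebra D) (e : B ≃L[ℂ] D), ∀ a b, e (a * b) = e a * e b

/-- A uniformly bounded representation of a group `G` in a unital normed algebra. -/
structure IsUniformlyBoundedRep {G A : Type*} [Group G] [Ring A] [Norm A] (π : G → A) : Prop where
  map_mul : ∀ g h, π (g * h) = π g * π h
  isUnit : ∀ g, IsUnit (π g)
  bounded : ∃ C : ℝ, ∀ g, ‖π g‖ ≤ C

/-- A subalgebra is a normed space under the restricted operations and norm. -/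
instance nonUnitalSubalgebraNormedSpace {A : Type*} [NonUnitalNormedRing A] [NormedSpace ℂ A]
    (B : NonUnitalSubalgebra ℂ A) : NormedSpace ℂ B where
  norm_smul_le c x := norm_smul_le c (x : A)

/-! ### The corona of `M₂` -/

/-- The complex two by two matrices, with the operator norm. -/
abbrev M2 : Type := Matrix (Fin 2) (Fin 2) ℂ

/-- The algebra of bounded sequences in `M₂`, with the supremum norm. -/
abbrev LInftyM2 : Type := lp (fun _ : ℕ => M2) ∞

/-- The ideal of sequences that tend to zero. -/
def c0M2 : Ideal LInftyM2 where
  carrier := {x | Tendsto (fun n => ‖x n‖) atTop (𝓝 0)}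
  zero_mem' := by simp
  add_mem' := by
    intro a b ha hb
    simp only [Set.mem_ofPred_eq] at ha hb ⊢
    refine squeeze_zero (fun n => norm_nonneg _) (fun n => ?_) (by simpa using ha.add hb)
    exact norm_add_le (a n) (b n)
  smul_mem' := by
    intro c x hx
    simp only [Set.mem_ofPred_eq] at hx ⊢
    refine squeeze_zero (fun n => norm_nonneg _) (fun n => ?_) (by simpa using hx.const_mul ‖c‖)
    exact (norm_mul_le (c n) (x n)).trans
      (mul_le_mul_of_nonneg_right (lp.norm_apply_le_norm ENNReal.top_ne_zero c n) (norm_nonneg _))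

instance c0M2_isTwoSided : c0M2.IsTwoSided where
  mul_mem_of_left := by
    intro x c hx
    change Tendsto (fun n => ‖x n‖) atTop (𝓝 0) at hx
    change Tendsto (fun n => ‖(x * c) n‖) atTop (𝓝 0)
    refine squeeze_zero (fun n => norm_nonneg _) (fun n => ?_) (by simpa using hx.mul_const ‖c‖)
    exact (norm_mul_le (x n) (c n)).trans
      (mul_le_mul_of_nonneg_left (lp.norm_apply_le_norm ENNReal.top_ne_zero c n) (norm_nonneg _))

/-- The corona `ℓ∞(ℕ, M₂) / c₀(ℕ, M₂)`, with the quotient norm. -/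
abbrev CoronaM2 : Type := LInftyM2 ⧸ c0M2

/-- The quotient map onto the corona. -/
abbrev coronaQ : LInftyM2 →+* CoronaM2 := Ideal.Quotient.mk c0M2

/-! ### Luzin gaps and the associated elements of the corona -/

/-- A well-ordered set of order type `ω₁`. -/
abbrev OmegaOne : Type := (Ordinal.omega 1 : Ordinal.{0}).ToType

/-- Luzin gaps: families of infinite sets of natural numbers, indexed by `ω₁`, that are almost
disjoint and such that for all `α` and `m` only finitely many `β < α` satisfy
`A α ∩ A β ⊆ {0, …, m - 1}`. -/
structure IsLuzinGap (A : OmegaOne → Set ℕ) : Prop where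
  infinite : ∀ α, (A α).Infinite
  almost_disjoint : ∀ α β, α ≠ β → (A α ∩ A β).Finite
  finite_below : ∀ (α : OmegaOne) (m : ℕ), {β | β < α ∧ A α ∩ A β ⊆ Set.Iio m}.Finite

/-- The canonical bijection from the power set of `ℕ` onto the Cantor ternary set. -/
def cantorPoint (S : Set ℕ) : ℝ := ∑' n : ℕ, S.indicator (fun n => 2 / (3 : ℝ) ^ (n + 1)) n

/-- The involution with rows `(1, 0)` and `(x, -1)`. -/
def sMatrix (x : ℝ) : M2 := !![1, 0; (x : ℂ), -1]

open Classical in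
/-- The bounded sequence in `M₂` that is `sMatrix (cantorPoint S)` on `S` and the identity matrix
off `S`. -/
def wElement (S : Set ℕ) : LInftyM2 :=
  ⟨fun n => if n ∈ S then sMatrix (cantorPoint S) else 1, memℓp_infty
    ⟨max ‖sMatrix (cantorPoint S)‖ ‖(1 : M2)‖, by
      rintro _ ⟨n, rfl⟩
      dsimp only
      split_ifs
      · exact le_max_left _ _
      · exact le_max_right _ _⟩⟩

end

/-! ### Combinatorics of `ω₁` and Luzin gaps -/

/-! Write `wElement S = 1 - 2 • pElement S`. Since the sets `A α` are almost disjoint, the images of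
the idempotents `pElement (A α)` in the corona are pairwise orthogonal. Hence the involutions
commute there, and beyond some coordinate a finite product of them has at most one factor different
from 1 at each place. This gives the uniformly bounded representation `luzinRep`. The closed span
pulls back to `luzinSet`, the sequences approximated modulo `c₀` by `unitComb A z c`. It is closed
in `ℓ∞(ℕ, M₂)`, which acts diagonally on a Hilbert space.

Amenability (`isAmenable_luzinAlgebra`): a dense set of elements lies in spans of finite groups with
a common norm bound, made of signed permutations on an initial segment and involutions after it. On
each span a derivation is implemented by an averaged functional of bounded norm, and a weak-star
limit of these functionals implements it everywhere.

The obstruction to being a C⋆-algebra: a bounded homomorphism from a C⋆-algebra to `M2`, even one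
that ignores the involution, satisfies `‖σ d‖² ≤ 2K²‖σ (d⋆ d)‖` (`norm_map_sq_le`). So self-adjoint
elements cannot have values close to a nonzero nilpotent. Along `A α`, every element of the algebra
converges into the span of 1 and `gapIdem A α`. If a subalgebra is a C⋆-algebra up to isomorphism
and one of its limits along `A α` is not scalar, then a self-adjoint element has limit `gapIdem A α`
or its complement (`exists_selfAdjoint_tendsto`). If this happened for uncountably many `α`, two
uncountable subfamilies would have their Cantor points a fixed distance apart
(`exists_uncountable_separated`). A Luzin gap forces members of the two to meet arbitrarily late
(`IsLuzinGap.exists_mem_inter`). At such a place the difference of two self-adjoint elements is near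
a multiple of `nMatrix` bounded away from 0, a contradiction. So only countably many `α` matter, and
the subalgebra is separable (`isSeparable_of_countable_support`). -/

theorem OmegaOne.countable_Iio (α : OmegaOne) : (Set.Iio α).Countable := by
  have h : Cardinal.mk OmegaOne = Cardinal.aleph 1 := by simp [OmegaOne]
  have h2 := Cardinal.mk_Iio_lt α (by rw [h]; simp [OmegaOne])
  rw [h, ← Cardinal.succ_aleph0] at h2
  rw [← Cardinal.le_aleph0_iff_set_countable]
  exact Order.lt_succ_iff.1 h2

theorem OmegaOne.not_countable_univ : ¬ (Set.univ : Set OmegaOne).Countable := by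
  rw [← Cardinal.le_aleph0_iff_set_countable, Cardinal.mk_univ]
  simp [OmegaOne]

/-- A countably infinite subset of `V` lies below all but countably many points, hence below some
point of `U`. -/
theorem OmegaOne.exists_infinite_below {U V : Set OmegaOne} (hU : ¬ U.Countable)
    (hV : ¬ V.Countable) : ∃ α ∈ U, {β | β ∈ V ∧ β < α}.Infinite := by
  have hVinf : V.Infinite := fun h => hV h.countable
  obtain ⟨f, hf⟩ : Nonempty (ℕ ↪ V) := ⟨hVinf.natEmbedding V⟩
  have hc : (⋃ i, Set.Iic (f i : OmegaOne)).Countable := by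
    refine Set.countable_iUnion fun i => ?_
    rw [← Set.Iio_insert]
    exact (OmegaOne.countable_Iio _).insert _
  obtain ⟨α, hα, hα'⟩ : ∃ α ∈ U, α ∉ ⋃ i, Set.Iic (f i : OmegaOne) := by
    by_contra! h
    exact hU (hc.mono h)
  refine ⟨α, hα, ?_⟩
  have : Set.range (fun i => (f i : OmegaOne)) ⊆ {β | β ∈ V ∧ β < α} := by
    rintro _ ⟨i, rfl⟩
    refine ⟨(f i).2, ?_⟩
    by_contra hlt
    exact hα' (Set.mem_iUnion.2 ⟨i, not_lt.1 hlt⟩)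
  refine Set.Infinite.mono this (Set.infinite_range_of_injective ?_)
  exact Subtype.val_injective.comp (Equiv.refl _ |>.injective.comp hf)

/-- Diagonalize: pick `k i ≥ i` in `B i` outside all earlier `B j`. The range of `k` meets `B i`
only in `k 0, …, k i`, and it meets it in `k i`, which is at least `i`. -/
theorem exists_luzin_extension_nat (B : ℕ → Set ℕ) (hB : ∀ i, (B i).Infinite)
    (hd : ∀ i j, i ≠ j → (B i ∩ B j).Finite) :
    ∃ S : Set ℕ, S.Infinite ∧ (∀ i, (S ∩ B i).Finite) ∧ ∀ m, {i | S ∩ B i ⊆ Set.Iio m}.Finite := by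
  have h : ∀ i, ∃ k ∈ B i, i ≤ k ∧ ∀ j < i, k ∉ B j := by
    intro i
    have hfin : (⋃ j ∈ Set.Iio i, (B i ∩ B j)).Finite :=
      (Set.finite_Iio i).biUnion fun j hj => hd i j (ne_of_gt hj)
    obtain ⟨k, hk, hk'⟩ := ((hB i).sdiff (hfin.union (Set.finite_Iio i))).nonempty
    simp only [Set.mem_union, Set.mem_iUnion, Set.mem_Iio, Set.mem_inter_iff, not_or,
      not_exists, not_and, not_lt] at hk'
    exact ⟨k, hk, hk'.2, fun j hj => hk'.1 j hj hk⟩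
  choose k hkB hik hk using h
  refine ⟨Set.range k, ?_, ?_, ?_⟩
  · refine Set.infinite_of_forall_exists_gt fun a => ⟨k (a + 1), ⟨_, rfl⟩, ?_⟩
    exact Nat.lt_of_succ_le (hik (a + 1))
  · intro i
    refine ((Set.finite_Iic i).image k).subset ?_
    rintro _ ⟨⟨j, rfl⟩, hj⟩
    refine ⟨j, ?_, rfl⟩
    by_contra hlt
    exact hk j i (not_le.1 hlt) hj
  · intro m
    refine (Set.finite_Iio m).subset fun i hi => ?_
    exact lt_of_le_of_lt (hik i) (hi ⟨⟨i, rfl⟩, hkB i⟩)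

theorem exists_luzin_extension {ι : Type*} [Countable ι] [Infinite ι] (B : ι → Set ℕ)
    (hB : ∀ i, (B i).Infinite) (hd : ∀ i j, i ≠ j → (B i ∩ B j).Finite) :
    ∃ S : Set ℕ, S.Infinite ∧ (∀ i, (S ∩ B i).Finite) ∧ ∀ m, {i | S ∩ B i ⊆ Set.Iio m}.Finite := by
  obtain ⟨e⟩ : Nonempty (ι ≃ ℕ) := by
    obtain ⟨d⟩ := nonempty_denumerable ι
    exact ⟨Denumerable.eqv ι⟩
  obtain ⟨S, h1, h2, h3⟩ := exists_luzin_extension_nat (fun i => B (e.symm i)) (fun i => hB _)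
    (fun i j hij => hd _ _ (e.symm.injective.ne hij))
  refine ⟨S, h1, fun i => by simpa using h2 (e i), fun m => ?_⟩
  refine ((h3 m).image e.symm).subset fun i hi => ⟨e i, ?_, by simp⟩
  simpa using hi

/-- A partition of `ℕ` into infinitely many infinite sets. -/
def columnSet (j : ℕ) : Set ℕ := {n | n.unpair.1 = j}

theorem columnSet_infinite (j : ℕ) : (columnSet j).Infinite := by
  refine (Set.infinite_range_of_injective (f := fun i => Nat.pair j i) ?_).mono ?_
  · intro a b hab
    exact (Nat.pair_eq_pair.1 hab).2
  · rintro _ ⟨i, rfl⟩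
    simp [columnSet]

/-- The requirement on the member of a Luzin gap that follows the sets `prev`. -/
def IsLuzinStep (α : OmegaOne) (prev : ∀ β : OmegaOne, β < α → Set ℕ) (S : Set ℕ) : Prop :=
  S.Infinite ∧ (∀ j, (S ∩ columnSet j).Finite) ∧ (∀ β h, (S ∩ prev β h).Finite) ∧
    ∀ m, {β | ∃ h : β < α, S ∩ prev β h ⊆ Set.Iio m}.Finite

/-- A family obtained by choosing every member according to `IsLuzinStep`. -/
noncomputable def luzinFamily : OmegaOne → Set ℕ :=
  WellFounded.fix (r := (· < ·)) wellFounded_lt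
    fun α prev => Classical.epsilon (IsLuzinStep α prev)

theorem luzinFamily_isLuzinStep (α : OmegaOne) :
    IsLuzinStep α (fun β _ => luzinFamily β) (luzinFamily α) := by
  induction α using WellFoundedLT.induction with
  | ind α ih =>
    have heq : luzinFamily α =
        Classical.epsilon (IsLuzinStep α (fun β _ => luzinFamily β)) := by
      rw [luzinFamily, WellFounded.fix_eq]
    rw [heq]
    apply Classical.epsilon_spec
    -- The columns join the earlier sets so that the index type is infinite even when `α` has only
    -- finitely many predecessors.
    have : Countable (Set.Iio α) := (OmegaOne.countable_Iio α).to_subtype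
    have hinf : ∀ i, (Sum.elim columnSet (fun β : Set.Iio α => luzinFamily β) i).Infinite := by
      rintro (j | β)
      · exact columnSet_infinite j
      · exact (ih β.1 β.2).1
    have hdisj : ∀ i j, i ≠ j → (Sum.elim columnSet (fun β : Set.Iio α => luzinFamily β) i ∩
        Sum.elim columnSet (fun β : Set.Iio α => luzinFamily β) j).Finite := by
      have aux : ∀ β γ : Set.Iio α, β < γ →
          (luzinFamily β ∩ luzinFamily γ).Finite := by
        intro β γ hβγ
        rw [Set.inter_comm]
        exact (ih γ.1 γ.2).2.2.1 β.1 hβγ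
      rintro (j | β) (i | γ) hne
      · have : columnSet j ∩ columnSet i = ∅ := by
          ext n
          simp only [columnSet, Set.mem_inter_iff, Set.mem_ofPred_eq, Set.mem_empty_iff_false,
            iff_false, not_and]
          rintro rfl h
          exact hne (by rw [h])
        simp [this]
      · rw [Set.inter_comm]
        exact (ih γ.1 γ.2).2.1 j
      · exact (ih β.1 β.2).2.1 i
      · have hne' : β ≠ γ := fun h => hne (by rw [h])
        rcases lt_or_gt_of_ne hne' with h | h
        · exact aux β γ h
        · rw [Set.inter_comm]
          exact aux γ β h
    obtain ⟨S, h1, h2, h3⟩ := exists_luzin_extension _ hinf hdisj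
    refine ⟨S, h1, fun j => h2 (Sum.inl j), fun β h => h2 (Sum.inr ⟨β, h⟩), fun m => ?_⟩
    have := ((h3 m).preimage (f := Sum.inr) Sum.inr_injective.injOn).image
      (Subtype.val : Set.Iio α → OmegaOne)
    refine this.subset ?_
    rintro β ⟨h, hβ⟩
    exact ⟨⟨β, h⟩, hβ, rfl⟩

theorem exists_isLuzinGap : ∃ A : OmegaOne → Set ℕ, IsLuzinGap A := by
  refine ⟨luzinFamily, ⟨fun α => (luzinFamily_isLuzinStep α).1, fun α β hne => ?_,
    fun α m => ?_⟩⟩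
  · rcases lt_or_gt_of_ne hne with h | h
    · rw [Set.inter_comm]
      exact (luzinFamily_isLuzinStep β).2.2.1 α h
    · exact (luzinFamily_isLuzinStep α).2.2.1 β h
  · refine ((luzinFamily_isLuzinStep α).2.2.2 m).subset ?_
    rintro β ⟨h, hβ⟩
    exact ⟨h, hβ⟩

/-- Two uncountable subfamilies of a Luzin gap cannot be separated. -/
theorem IsLuzinGap.exists_mem_inter {A : OmegaOne → Set ℕ} (hA : IsLuzinGap A)
    {U V : Set OmegaOne} (hU : ¬ U.Countable) (hV : ¬ V.Countable) (f : OmegaOne → ℕ) :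
    ∃ α ∈ U, ∃ β ∈ V, ∃ n, f α ≤ n ∧ f β ≤ n ∧ n ∈ A α ∧ n ∈ A β := by
  have aux : ∀ W : Set OmegaOne, ¬ W.Countable → ∃ m, ¬ {α ∈ W | f α ≤ m}.Countable := by
    intro W hW
    by_contra! h
    refine hW ((Set.countable_iUnion h).mono fun α hα => ?_)
    exact Set.mem_iUnion.2 ⟨f α, hα, le_rfl⟩
  -- Uncountable parts of `U` and `V` have `f` bounded by `m` and `k`. Some `α` in the first has
  -- infinitely many `β` of the second below it, and only finitely many of these meet `A α` inside
  -- `[0, max m k)`.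
  obtain ⟨m, hm⟩ := aux U hU
  obtain ⟨k, hk⟩ := aux V hV
  obtain ⟨α, hα, hinf⟩ := OmegaOne.exists_infinite_below hm hk
  obtain ⟨β, ⟨hβ, hlt⟩, hβ'⟩ := (hinf.sdiff (hA.finite_below α (max m k))).nonempty
  have : ¬ A α ∩ A β ⊆ Set.Iio (max m k) := fun h => hβ' ⟨hlt, h⟩
  obtain ⟨n, hn, hn'⟩ := Set.not_subset.1 this
  simp only [Set.mem_Iio, not_lt, max_le_iff] at hn'
  exact ⟨α, hα.1, β, hβ.1, n, hα.2.trans hn'.1, hβ.2.trans hn'.2, hn.1, hn.2⟩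

/-! ### Amenability through uniformly bounded finite groups -/

section

variable {A : Type} [NormedRing A] [NormedAlgebra ℂ A]

/-- A derivation into a dual bimodule is inner on the span of a finite group, and it is implemented
there by a functional of controlled norm. -/
theorem exists_implementing_functional {X : Type*} [NormedAddCommGroup X] [NormedSpace ℂ X]
    (L R : A →L[ℂ] X →L[ℂ] X)
    (hL : ∀ a b x, L (a * b) x = L a (L b x))
    (hR : ∀ a b x, R (a * b) x = R b (R a x))
    (hLR : ∀ a b x, L a (R b x) = R b (L a x))
    (D : A →L[ℂ] StrongDual ℂ X)
    (hD : ∀ a b x, D (a * b) x = D b (R a x) + D a (L b x))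
    {K : Type*} [Group K] [Finite K] (ρ : K →* A) {C : ℝ} (hC : ∀ k, ‖ρ k‖ ≤ C) :
    ∃ φ : StrongDual ℂ X, ‖φ‖ ≤ ‖D‖ * C * (‖L‖ * C) + ‖D‖ * ‖(1 : A)‖ * (‖R‖ * ‖(1 : A)‖) ∧
      ∀ a ∈ Submodule.span ℂ (Set.range ρ), ∀ x, D a x = φ (R a x) - φ (L a x) := by
  have := Fintype.ofFinite K
  have hC0 : 0 ≤ C := (norm_nonneg _).trans (hC 1)
  have hcard : (Fintype.card K : ℂ) ≠ 0 := by simp [Fintype.card_ne_zero]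
  -- The average over the group implements `D` up to the action of the unit. As 1 need not act as
  -- the identity on `X`, the term with `D 1` supplies what is missing. The norm bound does not
  -- involve the order of `K`.
  set φ : StrongDual ℂ X := -((Fintype.card K : ℂ)⁻¹ • ∑ g : K, (D (ρ g)).comp (L (ρ g⁻¹))) +
    (D 1).comp (R 1) with hφ
  have hφx : ∀ x, φ x = -((Fintype.card K : ℂ)⁻¹ * ∑ g : K, D (ρ g) (L (ρ g⁻¹) x)) +
      D 1 (R 1 x) := by
    intro x
    simp [hφ]
  have hinv : ∀ (h : K) (x : X), D (ρ h) x = φ (R (ρ h) x) - φ (L (ρ h) x) := by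
    intro h x
    have e1 : ∀ g : K, D (ρ g) (L (ρ g⁻¹) (R (ρ h) x)) =
        D (ρ (h * g)) (L (ρ (h * g)⁻¹) (L (ρ h) x)) - D (ρ h) (L 1 x) := by
      intro g
      rw [map_mul ρ h g, hD, ← hL, ← hL, ← map_mul, ← map_mul, hLR]
      simp [mul_assoc]
    have e2 : ∑ g : K, D (ρ g) (L (ρ g⁻¹) (R (ρ h) x)) =
        ∑ g : K, D (ρ g) (L (ρ g⁻¹) (L (ρ h) x)) - Fintype.card K * D (ρ h) (L 1 x) := by
      rw [Finset.sum_congr rfl fun g _ => e1 g, Finset.sum_sub_distrib,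
        Fintype.sum_equiv (Equiv.mulLeft h) (fun g => D (ρ (h * g)) (L (ρ (h * g)⁻¹) (L (ρ h) x)))
          (fun g => D (ρ g) (L (ρ g⁻¹) (L (ρ h) x))) (fun g => rfl)]
      simp
    have e3 : D 1 (R 1 (L (ρ h) x)) = 0 := by
      have h1 := hD 1 1 (R 1 (L (ρ h) x))
      have h2 : R 1 (R 1 (L (ρ h) x)) = R 1 (L (ρ h) x) := by rw [← hR, mul_one]
      have h3 : L 1 (R 1 (L (ρ h) x)) = R 1 (L (ρ h) x) := by rw [hLR, ← hL, one_mul]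
      rw [mul_one, h2, h3] at h1
      simpa using h1
    have e4 : R 1 (R (ρ h) x) = R (ρ h) x := by rw [← hR, mul_one]
    have e5 : D (ρ h) x = D 1 (R (ρ h) x) + D (ρ h) (L 1 x) := by
      have := hD (ρ h) 1 x
      rwa [mul_one] at this
    rw [hφx, hφx, e2, e3, e4, mul_sub, inv_mul_cancel_left₀ hcard, e5]
    ring
  refine ⟨φ, ?_, ?_⟩
  · refine ContinuousLinearMap.opNorm_le_bound _ (by positivity) fun x => ?_
    rw [hφx, add_mul]
    refine (norm_add_le _ _).trans (add_le_add ?_ ?_)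
    · rw [norm_neg, norm_mul, norm_inv, Complex.norm_natCast]
      have hN : (0 : ℝ) < Fintype.card K := by exact_mod_cast Fintype.card_pos
      rw [inv_mul_le_iff₀ hN]
      refine (norm_sum_le _ _).trans ?_
      refine (Finset.sum_le_card_nsmul _ _ (‖D‖ * C * (‖L‖ * C) * ‖x‖) fun g _ => ?_).trans
        (by simp)
      calc ‖D (ρ g) (L (ρ g⁻¹) x)‖ ≤ ‖D (ρ g)‖ * ‖L (ρ g⁻¹) x‖ := (D (ρ g)).le_opNorm _
        _ ≤ (‖D‖ * ‖ρ g‖) * (‖L (ρ g⁻¹)‖ * ‖x‖) := by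
            gcongr
            · exact D.le_opNorm _
            · exact (L (ρ g⁻¹)).le_opNorm _
        _ ≤ (‖D‖ * ‖ρ g‖) * ((‖L‖ * ‖ρ g⁻¹‖) * ‖x‖) := by
            gcongr
            exact L.le_opNorm _
        _ ≤ (‖D‖ * C) * ((‖L‖ * C) * ‖x‖) := by
            gcongr <;> exact hC _
        _ = _ := by ring
    · calc ‖D 1 (R 1 x)‖ ≤ ‖D 1‖ * ‖R 1 x‖ := (D 1).le_opNorm _
        _ ≤ (‖D‖ * ‖(1 : A)‖) * (‖R 1‖ * ‖x‖) := by
            gcongr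
            · exact D.le_opNorm _
            · exact (R 1).le_opNorm _
        _ ≤ (‖D‖ * ‖(1 : A)‖) * ((‖R‖ * ‖(1 : A)‖) * ‖x‖) := by
            gcongr
            exact R.le_opNorm _
        _ = _ := by ring
  · intro a ha x
    induction ha using Submodule.span_induction with
    | mem a ha =>
      obtain ⟨h, rfl⟩ := ha
      exact hinv h x
    | zero => simp
    | add a b _ _ ha hb =>
      simp only [map_add, add_apply, ha, hb]
      ring
    | smul c a _ ha =>
      simp only [map_smul, smul_apply, ha, smul_eq_mul]
      ring

/-- A unital Banach algebra is amenable if it is approximated by the spans of uniformly bounded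
finite groups. -/
theorem isAmenable_of_finite_groups {ι : Type*} (l : Filter ι) [l.NeBot] (K : ι → Type*)
    [∀ i, Group (K i)] [∀ i, Finite (K i)] (ρ : ∀ i, K i →* A) {C : ℝ}
    (hC : ∀ i k, ‖ρ i k‖ ≤ C) (T : Set A) (hT : Dense T)
    (hTρ : ∀ a ∈ T, ∀ᶠ i in l, a ∈ Submodule.span ℂ (Set.range (ρ i))) :
    IsAmenableBanachAlgebra A := by
  intro X _ _ _ L R hL hR hLR D hD
  choose φ hφn hφ using fun i => exists_implementing_functional L R hL hR hLR D hD (ρ i) (hC i)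
  set M := ‖D‖ * C * (‖L‖ * C) + ‖D‖ * ‖(1 : A)‖ * (‖R‖ * ‖(1 : A)‖)
  -- The functionals lie in one ball, which is weak-star compact, so they converge along an
  -- ultrafilter.
  let U : Ultrafilter ι := Ultrafilter.of l
  have hUl : (U : Filter ι) ≤ l := Ultrafilter.of_le l
  have hcpt := WeakDual.isCompact_closedBall (𝕜 := ℂ) (0 : StrongDual ℂ X) M
  obtain ⟨ψ, -, hψ⟩ := hcpt.ultrafilter_le_nhds (U.map fun i => StrongDual.toWeakDual (φ i)) (by
    rw [Filter.le_principal_iff, Ultrafilter.coe_map, Filter.mem_map]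
    refine Filter.Eventually.of_forall fun i => ?_
    simpa using hφn i)
  have hlim : ∀ x, Tendsto (fun i => φ i x) U (𝓝 (ψ x)) := by
    intro x
    exact ((WeakDual.eval_continuous x).tendsto ψ).comp hψ
  refine ⟨WeakDual.toStrongDual ψ, fun a x => ?_⟩
  have hTa : ∀ a ∈ T, D a x = ψ (R a x) - ψ (L a x) := by
    intro a ha
    refine tendsto_nhds_unique (f := fun i => D a x) (l := (U : Filter ι)) tendsto_const_nhds ?_
    refine ((hlim (R a x)).sub (hlim (L a x))).congr' ?_
    filter_upwards [hUl (hTρ a ha)] with i hi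
    exact (hφ i a hi x).symm
  have hcl : IsClosed {a : A | D a x = WeakDual.toStrongDual ψ (R a x) -
      WeakDual.toStrongDual ψ (L a x)} := by
    refine isClosed_eq ?_ ?_ <;> fun_prop
  exact (hcl.closure_subset_iff.2 fun a ha => hTa a ha) (hT a)

end

/-! ### The action of `ℓ∞(ℕ, M₂)` on a Hilbert space -/

/-- The Hilbert space of square summable sequences in `ℂ²`. -/
abbrev SeqHilbert : Type := lp (fun _ : ℕ => EuclideanSpace ℂ (Fin 2)) 2

theorem LInftyM2.norm_apply_le (x : LInftyM2) (n : ℕ) : ‖x n‖ ≤ ‖x‖ :=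
  lp.norm_apply_le_norm ENNReal.top_ne_zero x n

theorem M2.norm_toEuclideanCLM (M : M2) :
    ‖Matrix.toEuclideanCLM (n := Fin 2) (𝕜 := ℂ) M‖ = ‖M‖ := rfl

theorem memℓp_two_action (x : LInftyM2) (ξ : SeqHilbert) :
    Memℓp (fun n => Matrix.toEuclideanCLM (n := Fin 2) (𝕜 := ℂ) (x n) (ξ n)) 2 := by
  have h := (memℓp_gen_iff (by norm_num : (0 : ℝ) < (2 : ℝ≥0∞).toReal)).1 (lp.memℓp ξ)
  refine (memℓp_gen_iff (by norm_num)).2 ?_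
  refine Summable.of_nonneg_of_le (fun n => by positivity) (fun n => ?_)
    (h.mul_left (‖x‖ ^ (2 : ℝ≥0∞).toReal))
  rw [← Real.mul_rpow (norm_nonneg _) (norm_nonneg _)]
  refine Real.rpow_le_rpow (norm_nonneg _) ?_ (by norm_num)
  refine (ContinuousLinearMap.le_opNorm _ _).trans ?_
  rw [M2.norm_toEuclideanCLM]
  gcongr
  exact x.norm_apply_le n

/-- The diagonal action of a bounded sequence of matrices. -/
noncomputable def LInftyM2.act (x : LInftyM2) : SeqHilbert →L[ℂ] SeqHilbert :=
  LinearMap.mkContinuous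
    { toFun := fun ξ =>
        ⟨fun n => Matrix.toEuclideanCLM (n := Fin 2) (𝕜 := ℂ) (x n) (ξ n), memℓp_two_action x ξ⟩
      map_add' := fun ξ η => by ext1; funext n; exact map_add _ _ _
      map_smul' := fun c ξ => by ext1; funext n; exact (Matrix.toEuclideanCLM (n := Fin 2) (𝕜 := ℂ) (x n)).map_smul c (ξ n) } ‖x‖ (by
    intro ξ
    have h0 : (0 : ℝ) < (2 : ℝ≥0∞).toReal := by norm_num
    refine lp.norm_le_of_tsum_le h0 (by positivity) ?_
    have h := (memℓp_gen_iff h0).1 (lp.memℓp ξ)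
    rw [Real.mul_rpow (norm_nonneg _) (norm_nonneg _), lp.norm_rpow_eq_tsum h0 ξ, ← tsum_mul_left]
    refine Summable.tsum_le_tsum (fun n => ?_)
      ((memℓp_gen_iff h0).1 (memℓp_two_action x ξ)) (h.mul_left _)
    rw [← Real.mul_rpow (norm_nonneg _) (norm_nonneg _)]
    refine Real.rpow_le_rpow (norm_nonneg _) ?_ h0.le
    refine (ContinuousLinearMap.le_opNorm _ _).trans ?_
    rw [M2.norm_toEuclideanCLM]
    gcongr
    exact x.norm_apply_le n)

theorem LInftyM2.act_apply (x : LInftyM2) (ξ : SeqHilbert) (n : ℕ) :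
    x.act ξ n = Matrix.toEuclideanCLM (n := Fin 2) (𝕜 := ℂ) (x n) (ξ n) := rfl

/-- Vectors concentrated at one coordinate already detect the norm of each `x n`. -/
theorem LInftyM2.norm_act (x : LInftyM2) : ‖x.act‖ = ‖x‖ := by
  refine le_antisymm (LinearMap.mkContinuous_norm_le _ (norm_nonneg _) _) ?_
  refine lp.norm_le_of_forall_le (norm_nonneg _) fun n => ?_
  rw [← M2.norm_toEuclideanCLM]
  refine ContinuousLinearMap.opNorm_le_bound _ (norm_nonneg _) fun v => ?_
  have h1 : x.act (lp.single 2 n v) n = Matrix.toEuclideanCLM (n := Fin 2) (𝕜 := ℂ) (x n) v := by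
    rw [LInftyM2.act_apply, lp.single_apply_self]
  rw [← h1]
  refine (lp.norm_apply_le_norm (by norm_num) _ n).trans ?_
  refine (x.act.le_opNorm _).trans ?_
  rw [lp.norm_single (by norm_num)]

/-- The faithful representation of `ℓ∞(ℕ, M₂)` by diagonal operators. -/
noncomputable def LInftyM2.rep : LInftyM2 →ₙₐ[ℂ] (SeqHilbert →L[ℂ] SeqHilbert) where
  toFun := LInftyM2.act
  map_smul' c x := by
    ext1 ξ; ext1; funext n
    exact congrArg (fun T => T (ξ n)) (map_smul (Matrix.toEuclideanCLM (n := Fin 2) (𝕜 := ℂ)) c (x n))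
  map_zero' := by
    ext1 ξ; ext1; funext n
    exact congrArg (fun T => T (ξ n)) (map_zero (Matrix.toEuclideanCLM (n := Fin 2) (𝕜 := ℂ)))
  map_add' x y := by
    ext1 ξ; ext1; funext n
    exact congrArg (fun T => T (ξ n))
      (map_add (Matrix.toEuclideanCLM (n := Fin 2) (𝕜 := ℂ)) (x n) (y n))
  map_mul' x y := by
    ext1 ξ; ext1; funext n
    exact congrArg (fun T => T (ξ n))
      (map_mul (Matrix.toEuclideanCLM (n := Fin 2) (𝕜 := ℂ)) (x n) (y n))

theorem isOperatorAlgebra_of_isometry {A : Type} [NonUnitalNormedRing A] [NormedSpace ℂ A]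
    [CompleteSpace A] (j : A →ₗ[ℂ] LInftyM2) (hmul : ∀ x y, j (x * y) = j x * j y)
    (hj : ∀ x, ‖j x‖ = ‖x‖) : IsOperatorAlgebra A := by
  refine ⟨inferInstance, SeqHilbert, inferInstance, inferInstance, inferInstance,
    { toFun := fun x => LInftyM2.rep (j x)
      map_smul' := fun c x => by rw [map_smul, map_smul]; rfl
      map_zero' := by rw [map_zero, map_zero]
      map_add' := fun x y => by rw [map_add, map_add]
      map_mul' := fun x y => by rw [hmul, map_mul] }, ?_⟩
  refine Isometry.of_dist_eq fun x y => ?_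
  change dist (LInftyM2.rep (j x)) (LInftyM2.rep (j y)) = dist x y
  rw [dist_eq_norm, dist_eq_norm, ← map_sub, ← map_sub, ← hj (x - y)]
  exact LInftyM2.norm_act _

theorem isOperatorAlgebra_of_isClosed (S : Subalgebra ℂ LInftyM2)
    (hS : IsClosed (S : Set LInftyM2)) : IsOperatorAlgebra S :=
  have : CompleteSpace S := hS.completeSpace_coe
  isOperatorAlgebra_of_isometry (Subalgebra.toSubmodule S).subtype (fun _ _ => rfl) fun _ => rfl

/-! ### Homomorphisms from C⋆-algebras into `M₂` -/

theorem M2.mul_self_eq (M : M2) : M * M = M.trace • M - M.det • (1 : M2) := by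
  ext i j
  fin_cases i <;> fin_cases j <;>
    simp [Matrix.mul_apply, Fin.sum_univ_two, Matrix.trace_fin_two, Matrix.det_fin_two] <;> ring

/-- Roots of the characteristic polynomial are eigenvalues, hence bounded by the norm. -/
theorem M2.charpoly_ne_zero (M : M2) {t : ℝ} (ht : ‖M‖ < t) :
    (t : ℂ) ^ 2 - M.trace * t + M.det ≠ 0 := by
  intro h
  have hdet : (algebraMap ℂ M2 t - M).det = 0 := by
    rw [← h]
    simp [Matrix.det_fin_two, Matrix.trace_fin_two, Matrix.algebraMap_matrix_apply]
    ring
  have hs : (t : ℂ) ∈ spectrum ℂ M := by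
    rw [spectrum.mem_iff, Matrix.isUnit_iff_isUnit_det, hdet]
    simp
  have := spectrum.norm_le_norm_of_mem hs
  have h0 : 0 ≤ ‖M‖ := norm_nonneg M
  rw [Complex.norm_real, Real.norm_eq_abs, abs_of_pos (by linarith)] at this
  linarith

/-- The continuous function that is `0` on `[0, r]`, is `1` on `[2 r, ∞)` and is affine between. -/
noncomputable def ramp (r t : ℝ) : ℝ := max 0 (min 1 (t / r - 1))

theorem continuous_ramp (r : ℝ) : Continuous (ramp r) := by
  unfold ramp; fun_prop

theorem ramp_of_le {r t : ℝ} (hr : 0 < r) (h : t ≤ r) : ramp r t = 0 := by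
  have : t / r ≤ 1 := (div_le_one hr).2 h
  exact max_eq_left ((min_le_right _ _).trans (by linarith))

theorem ramp_of_ge {r t : ℝ} (hr : 0 < r) (h : 2 * r ≤ t) : ramp r t = 1 := by
  have : 2 ≤ t / r := by rwa [le_div_iff₀ hr]
  rw [ramp, min_eq_left (by linarith)]
  simp

theorem ramp_nonneg (r t : ℝ) : 0 ≤ ramp r t := le_max_left _ _

theorem ramp_le_one (r t : ℝ) : ramp r t ≤ 1 := max_le zero_le_one (min_le_left _ _)

section

variable {D : Type*} [NonUnitalCStarAlgebra D]

/-- Cut off the spectrum of a positive element above the norm of its image. -/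
theorem map_cfc_ramp_eq_zero (σ : D →ₙₐ[ℂ] M2) (a : D) (ha : IsSelfAdjoint a) {r : ℝ}
    (hr : ‖σ a‖ < r) : σ (cfcₙ (fun z : ℂ => (ramp r z.re : ℂ)) a) = 0 := by
  have hr0 : 0 < r := (norm_nonneg _).trans_lt hr
  set s := (σ a).trace
  set p := (σ a).det
  -- `P` is the characteristic polynomial of `σ a`. Its real roots lie below `r`, where the cutoff
  -- `q` vanishes, so `k = q / P` is continuous. Then `q(a) = P(a) k(a)`, and `σ` sends this to 0 by
  -- Cayley–Hamilton.
  set P : ℂ → ℂ := fun z => (z.re : ℂ) ^ 2 - s * z.re + p with hP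
  set q : ℂ → ℂ := fun z => (ramp r z.re : ℂ) with hq
  set k : ℂ → ℂ := fun z => q z / P z with hk
  have hPc : Continuous P := by fun_prop
  have hqc : Continuous q := by
    have := continuous_ramp r
    fun_prop
  have hP0 : ∀ z : ℂ, P z = 0 → z.re < r := by
    intro z hz
    by_contra! h
    exact M2.charpoly_ne_zero (σ a) (hr.trans_le h) hz
  have hq0 : ∀ z : ℂ, z.re ≤ r → q z = 0 := by
    intro z hz
    simp [hq, ramp_of_le hr0 hz]
  have hkc : Continuous k := by
    rw [continuous_iff_continuousAt]
    intro z
    by_cases hz : P z = 0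
    · have h1 : ∀ᶠ w in 𝓝 z, w.re < r :=
        (Complex.continuous_re.tendsto z).eventually (gt_mem_nhds (hP0 z hz))
      have h2 : k =ᶠ[𝓝 z] fun _ => 0 := by
        filter_upwards [h1] with w hw
        simp [hk, hq0 w hw.le]
      exact continuousAt_const.congr h2.symm
    · exact hqc.continuousAt.div hPc.continuousAt hz
  have hk0 : k 0 = 0 := by simp [hk, hq0 0 (by simpa using hr0.le)]
  -- The quasispectrum is real, so `z.re` may be replaced by `z`; every summand vanishes at 0, as
  -- the non-unital functional calculus demands.
  have hqeq : ∀ z ∈ quasispectrum ℂ a, q z = z * (z * k z) - s * (z * k z) + p * k z := by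
    intro z hz
    have hre : ((z.re : ℝ) : ℂ) = z := by
      have := ha.quasispectrumRestricts.algebraMap_image
      rw [← this] at hz
      obtain ⟨t, -, rfl⟩ := hz
      simp
    have : q z = P z * k z := by
      by_cases hz : P z = 0
      · rw [hq0 z (hP0 z hz).le, hz, zero_mul]
      · rw [hk]; field_simp
    rw [this, hP]
    simp only [hre]
    ring
  have han : IsStarNormal a := ha.isStarNormal
  have e1 : cfcₙ (fun z => z * k z) a = a * cfcₙ k a := by
    rw [cfcₙ_mul (fun z => z) k a (by fun_prop) rfl (by fun_prop) hk0, cfcₙ_id' ℂ a]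
  have e2 : cfcₙ (fun z => z * (z * k z)) a = a * (a * cfcₙ k a) := by
    rw [cfcₙ_mul (fun z => z) (fun z => z * k z) a (by fun_prop) rfl (by fun_prop) (by simp),
      cfcₙ_id' ℂ a, e1]
  have e3 : cfcₙ q a = a * (a * cfcₙ k a) - s • (a * cfcₙ k a) + p • cfcₙ k a := by
    rw [cfcₙ_congr hqeq, cfcₙ_add _ _ a (by fun_prop) (by simp) (by fun_prop) (by simp [hk0]),
      cfcₙ_sub _ _ a (by fun_prop) (by simp) (by fun_prop) (by simp), e2,
      cfcₙ_const_mul s (fun z => z * k z) a (by fun_prop) (by simp), e1,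
      cfcₙ_const_mul p k a (by fun_prop) hk0]
  have hM := M2.mul_self_eq (σ a)
  rw [e3]
  simp only [map_add, map_sub, map_mul, map_smul, ← mul_assoc, hM]
  simp only [sub_mul, smul_mul_assoc, one_mul]
  abel_nf
  simp [s, p]

/-- For `r > ‖σ a‖`, `a = d d⋆`, the cutoff `c` of `a` is killed by `σ`, so `d⋆` may be replaced by
`y = d⋆(1 - c)`. The C⋆-identity and the functional calculus bound `‖y‖²` by the supremum of `t (1 -
ramp r t)²`, which is at most `2r`. Finally `r` decreases to `‖σ a‖`. -/
theorem norm_map_star_sq_le (σ : D →ₙₐ[ℂ] M2) {K : ℝ} (hK : ∀ d, ‖σ d‖ ≤ K * ‖d‖) (d : D) :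
    ‖σ (star d)‖ ^ 2 ≤ 2 * K ^ 2 * ‖σ (d * star d)‖ := by
  set a := d * star d with had
  have ha : IsSelfAdjoint a := IsSelfAdjoint.mul_star_self d
  have key : ∀ r, ‖σ a‖ < r → ‖σ (star d)‖ ^ 2 ≤ 2 * K ^ 2 * r := by
    intro r hr
    have hr0 : 0 < r := (norm_nonneg _).trans_lt hr
    set q : ℂ → ℂ := fun z => (ramp r z.re : ℂ) with hq
    have hqc : Continuous q := by
      have := continuous_ramp r
      fun_prop
    have hq0 : q 0 = 0 := by simp [hq, ramp_of_le hr0 hr0.le]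
    have han : IsStarNormal a := ha.isStarNormal
    set c := cfcₙ q a with hc
    have hcs : star c = c := by
      rw [hc, ← cfcₙ_star]
      congr 1
      ext z
      simp [hq]
    have h0 : σ c = 0 := map_cfc_ramp_eq_zero σ a ha hr
    set y := star d - star d * c with hy
    have h1 : σ (star d) = σ y := by simp [hy, h0]
    have h2 : star y * y = a - a * c - c * a + c * (a * c) := by
      have : star y = d - c * d := by simp [hy, hcs]
      rw [this, hy, had]
      noncomm_ring
    have h3 : star y * y = cfcₙ (fun z => z - z * q z - q z * z + q z * (z * q z)) a := by
      rw [h2, cfcₙ_add _ _ a (by fun_prop) (by simp) (by fun_prop) (by simp),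
        cfcₙ_sub _ _ a (by fun_prop) (by simp) (by fun_prop) (by simp),
        cfcₙ_sub _ _ a (by fun_prop) (by simp) (by fun_prop) (by simp),
        cfcₙ_mul q (fun z => z * q z) a (by fun_prop) hq0 (by fun_prop) (by simp),
        cfcₙ_mul q (fun z => z) a (by fun_prop) hq0 (by fun_prop) (by simp),
        cfcₙ_mul (fun z => z) q a (by fun_prop) (by simp) (by fun_prop) hq0,
        cfcₙ_id' ℂ a]
    have h4 : ‖star y * y‖ ≤ 2 * r := by
      rw [h3]
      refine norm_cfcₙ_le fun z hz => ?_
      rw [← ha.quasispectrumRestricts.algebraMap_image] at hz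
      obtain ⟨t, ht, rfl⟩ := hz
      have ht0 : 0 ≤ t := by
        let _ := CStarAlgebra.spectralOrder D
        have := CStarAlgebra.spectralOrderedRing D
        exact quasispectrum_nonneg_of_nonneg a (mul_star_self_nonneg d) t ht
      have hval : (t : ℂ) - t * q t - q t * t + q t * (t * q t) =
          ((t * (1 - ramp r t) ^ 2 : ℝ) : ℂ) := by
        simp only [hq, Complex.ofReal_re]
        push_cast
        ring
      have hq1 := ramp_nonneg r t
      have hq2 := ramp_le_one r t
      simp only [Complex.coe_algebraMap]
      rw [hval, Complex.norm_real, Real.norm_eq_abs, abs_of_nonneg (by positivity)]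
      rcases le_total (2 * r) t with h | h
      · rw [ramp_of_ge hr0 h]
        simp only [sub_self, ne_eq, OfNat.ofNat_ne_zero, not_false_eq_true, zero_pow, mul_zero]
        positivity
      · have : (1 - ramp r t) ^ 2 ≤ 1 := by nlinarith
        nlinarith
    have h5 : ‖y‖ ^ 2 ≤ 2 * r := by
      rw [sq, ← CStarRing.norm_star_mul_self]; exact h4
    calc ‖σ (star d)‖ ^ 2 = ‖σ y‖ ^ 2 := by rw [h1]
      _ ≤ (K * ‖y‖) ^ 2 := by gcongr; exact hK y
      _ = K ^ 2 * ‖y‖ ^ 2 := by ring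
      _ ≤ K ^ 2 * (2 * r) := by gcongr
      _ = 2 * K ^ 2 * r := by ring
  refine le_of_forall_pos_le_add fun ε hε => ?_
  have := key (‖σ a‖ + ε / (2 * K ^ 2 + 1)) (by simp; positivity)
  refine this.trans ?_
  have h : 2 * K ^ 2 * (ε / (2 * K ^ 2 + 1)) ≤ ε := by
    rw [mul_div_assoc', div_le_iff₀ (by positivity)]
    nlinarith
  linarith

/-- Up to a constant, a bounded homomorphism to `M₂` satisfies the C⋆-inequality. -/
theorem norm_map_sq_le (σ : D →ₙₐ[ℂ] M2) {K : ℝ} (hK : ∀ d, ‖σ d‖ ≤ K * ‖d‖) (d : D) :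
    ‖σ d‖ ^ 2 ≤ 2 * K ^ 2 * ‖σ (star d * d)‖ := by
  simpa using norm_map_star_sq_le σ hK (star d)

end

/-! ### The idempotents `(1 - s) / 2` -/

theorem cantorPoint_eq (S : Set ℕ) [DecidablePred (· ∈ S)] :
    cantorPoint S = 2 / 3 * Cardinal.cantorFunction (1 / 3) (fun n => decide (n ∈ S)) := by
  rw [cantorPoint, Cardinal.cantorFunction, ← tsum_mul_left]
  refine tsum_congr fun n => ?_
  by_cases h : n ∈ S
  · simp [Cardinal.cantorFunctionAux, h, pow_succ]
    ring
  · simp [Cardinal.cantorFunctionAux, h]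

theorem cantorPoint_injective : Function.Injective cantorPoint := by
  classical
  intro S T h
  rw [cantorPoint_eq, cantorPoint_eq] at h
  have := Cardinal.cantorFunction_injective (by norm_num : (0 : ℝ) < 1 / 3) (by norm_num)
    (mul_left_cancel₀ (by norm_num) h)
  ext n
  simpa using congrFun this n

theorem abs_cantorPoint_le (S : Set ℕ) : |cantorPoint S| ≤ 1 := by
  have hs : HasSum (fun n : ℕ => 2 / (3 : ℝ) ^ (n + 1)) 1 := by
    have h := (hasSum_geometric_of_lt_one (by norm_num : (0 : ℝ) ≤ 1 / 3) (by norm_num)).mul_left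
      (2 / 3 : ℝ)
    have h1 : (2 / 3 : ℝ) * (1 - 1 / 3)⁻¹ = 1 := by norm_num
    have h2 : (fun n : ℕ => 2 / (3 : ℝ) ^ (n + 1)) = fun n => 2 / 3 * (1 / 3) ^ n := by
      ext n
      rw [pow_succ, one_div, inv_pow]
      field_simp
    rwa [h1, ← h2] at h
  have h0 : ∀ n, 0 ≤ S.indicator (fun n : ℕ => 2 / (3 : ℝ) ^ (n + 1)) n := fun n =>
    Set.indicator_nonneg (fun _ _ => by positivity) n
  rw [cantorPoint, abs_of_nonneg (tsum_nonneg h0), ← hs.tsum_eq]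
  exact Summable.tsum_le_tsum (fun n => Set.indicator_le_self' (fun _ _ => by positivity) n)
    (hs.summable.of_nonneg_of_le h0
      fun n => Set.indicator_le_self' (fun _ _ => by positivity) n) hs.summable

/-- The idempotent `(1 - sMatrix x) / 2`. -/
noncomputable def pMatrix (x : ℝ) : M2 := !![0, 0; -((x : ℂ) / 2), 1]

/-- The direction in which `pMatrix` varies. -/
noncomputable def nMatrix : M2 := !![0, 0; -(1 / 2), 0]

theorem sMatrix_eq (x : ℝ) : sMatrix x = 1 - (2 : ℂ) • pMatrix x := by
  ext i j
  fin_cases i <;> fin_cases j <;> simp [sMatrix, pMatrix]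
  · ring
  · norm_num

/-- All these idempotents have the same range, the second coordinate axis. -/
theorem pMatrix_mul (x y : ℝ) : pMatrix x * pMatrix y = pMatrix y := by
  ext i j
  fin_cases i <;> fin_cases j <;> simp [pMatrix, Matrix.mul_apply, Fin.sum_univ_two]

theorem pMatrix_sub (x y : ℝ) : pMatrix x - pMatrix y = ((x - y : ℝ) : ℂ) • nMatrix := by
  ext i j
  fin_cases i <;> fin_cases j <;> simp [pMatrix, nMatrix]
  ring

theorem nMatrix_mul_self : nMatrix * nMatrix = 0 := by
  ext i j
  fin_cases i <;> fin_cases j <;> simp [nMatrix, Matrix.mul_apply, Fin.sum_univ_two]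

theorem M2.norm_entry_le (M : M2) (i j : Fin 2) : ‖M i j‖ ≤ ‖M‖ := by
  have h := Matrix.l2_opNorm_mulVec M (EuclideanSpace.single j 1)
  rw [PiLp.norm_single, norm_one, mul_one] at h
  refine le_trans ?_ h
  refine le_trans (le_of_eq ?_) (PiLp.norm_apply_le _ i)
  simp

/-- A bound for the norms of `pMatrix x`, `|x| ≤ 1`. -/
noncomputable def pBound : ℝ := ‖pMatrix 0‖ + ‖nMatrix‖

theorem pBound_nonneg : 0 ≤ pBound := by unfold pBound; positivity

theorem norm_pMatrix_le {x : ℝ} (hx : |x| ≤ 1) : ‖pMatrix x‖ ≤ pBound := by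
  have h : pMatrix x = pMatrix 0 + (x : ℂ) • nMatrix := by
    rw [← sub_eq_iff_eq_add', pMatrix_sub, sub_zero]
  rw [h, pBound]
  refine (norm_add_le _ _).trans ?_
  gcongr
  rw [norm_smul, Complex.norm_real, Real.norm_eq_abs]
  exact mul_le_of_le_one_left (norm_nonneg _) hx

theorem one_le_norm_pMatrix (x : ℝ) : 1 ≤ ‖pMatrix x‖ := by
  simpa [pMatrix] using M2.norm_entry_le (pMatrix x) 1 1

open Classical in
/-- The bounded sequence that is `pMatrix (cantorPoint S)` on `S` and zero off `S`. -/
noncomputable def pElement (S : Set ℕ) : LInftyM2 :=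
  ⟨fun n => if n ∈ S then pMatrix (cantorPoint S) else 0, memℓp_infty
    ⟨pBound, by
      rintro _ ⟨n, rfl⟩
      dsimp only
      split_ifs
      · exact norm_pMatrix_le (abs_cantorPoint_le S)
      · simpa using pBound_nonneg⟩⟩

theorem pElement_of_mem {S : Set ℕ} {n : ℕ} (h : n ∈ S) :
    pElement S n = pMatrix (cantorPoint S) := if_pos h

theorem pElement_of_notMem {S : Set ℕ} {n : ℕ} (h : n ∉ S) : pElement S n = 0 := if_neg h

theorem wElement_eq (S : Set ℕ) : wElement S = 1 - (2 : ℂ) • pElement S := by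
  ext1
  funext n
  rw [lp.coeFn_sub, Pi.sub_apply, lp.infty_coeFn_one, lp.coeFn_smul, Pi.smul_apply, Pi.one_apply]
  by_cases h : n ∈ S
  · rw [pElement_of_mem h, ← sMatrix_eq]
    exact if_pos h
  · rw [pElement_of_notMem h, smul_zero, sub_zero]
    exact if_neg h

/-! ### The corona -/

theorem coronaQ_add (x y : LInftyM2) : coronaQ (x + y) = coronaQ x + coronaQ y := rfl

theorem coronaQ_sub (x y : LInftyM2) : coronaQ (x - y) = coronaQ x - coronaQ y := rfl

theorem coronaQ_mul (x y : LInftyM2) : coronaQ (x * y) = coronaQ x * coronaQ y := rfl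

theorem coronaQ_smul (r : ℂ) (x : LInftyM2) : coronaQ (r • x) = r • coronaQ x := rfl

theorem coronaQ_one : coronaQ 1 = 1 := rfl

theorem coronaQ_zero : coronaQ 0 = 0 := rfl

theorem coronaQ_eq_of_eventuallyEq {x y : LInftyM2} (h : ∀ᶠ n in atTop, x n = y n) :
    coronaQ x = coronaQ y := by
  rw [Ideal.Quotient.eq]
  change Tendsto (fun n => ‖(x - y) n‖) atTop (𝓝 0)
  refine tendsto_const_nhds.congr' ?_
  filter_upwards [h] with n hn
  rw [lp.coeFn_sub, Pi.sub_apply, hn, sub_self, norm_zero]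

open Classical in
/-- The sequence `x` on `[m, ∞)`, preceded by `m` zeros. -/
noncomputable def LInftyM2.tail (m : ℕ) (x : LInftyM2) : LInftyM2 :=
  ⟨fun n => if n < m then 0 else x n, memℓp_infty
    ⟨‖x‖, by
      rintro _ ⟨n, rfl⟩
      dsimp only
      split_ifs
      · simp
      · exact lp.norm_apply_le_norm ENNReal.top_ne_zero x n⟩⟩

theorem LInftyM2.tail_of_lt {m n : ℕ} (x : LInftyM2) (h : n < m) : x.tail m n = 0 := if_pos h

theorem LInftyM2.tail_of_le {m n : ℕ} (x : LInftyM2) (h : m ≤ n) : x.tail m n = x n :=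
  if_neg (not_lt.2 h)

theorem norm_coronaQ_le {x : LInftyM2} {C : ℝ} (h : ∀ᶠ n in atTop, ‖x n‖ ≤ C) :
    ‖coronaQ x‖ ≤ C := by
  obtain ⟨m, hm⟩ := eventually_atTop.1 h
  have hC : 0 ≤ C := (norm_nonneg _).trans (hm m le_rfl)
  have : coronaQ x = coronaQ (x.tail m) := coronaQ_eq_of_eventuallyEq
    (eventually_atTop.2 ⟨m, fun n hn => (x.tail_of_le hn).symm⟩)
  rw [this]
  refine (Submodule.Quotient.norm_mk_le c0M2 (x.tail m)).trans ?_
  refine lp.norm_le_of_forall_le hC fun n => ?_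
  rcases lt_or_ge n m with hn | hn
  · rw [x.tail_of_lt hn, norm_zero]
    exact hC
  · rw [x.tail_of_le hn]
    exact hm n hn

/-- Together with `norm_coronaQ_le` this says that the quotient norm is the limit superior of the
coordinate norms. -/
theorem eventually_norm_le_of_norm_coronaQ_lt {x : LInftyM2} {ε : ℝ} (h : ‖coronaQ x‖ < ε) :
    ∀ᶠ n in atTop, ‖x n‖ ≤ ε := by
  obtain ⟨y, hy, hyn⟩ := Submodule.Quotient.norm_mk_lt (S := c0M2) (coronaQ x)
    (ε := ε - ‖coronaQ x‖) (by linarith)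
  rw [add_sub_cancel] at hyn
  have hxy : Tendsto (fun n => ‖(x - y) n‖) atTop (𝓝 0) := (Ideal.Quotient.eq (I := c0M2)).1 hy.symm
  filter_upwards [hxy.eventually (gt_mem_nhds (sub_pos.2 hyn))] with n hn
  have h1 : x n = (x - y) n + y n := by simp
  have h2 : ‖y n‖ ≤ ‖y‖ := lp.norm_apply_le_norm ENNReal.top_ne_zero y n
  rw [h1]
  refine (norm_add_le _ _).trans ?_
  linarith

/-! ### Linear combinations of the idempotents -/

section

variable (A : OmegaOne → Set ℕ)

/-- `Separates A F m` says that the sets `A α`, `α ∈ F`, are disjoint on `[m, ∞)`. -/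
def Separates (F : Finset OmegaOne) (m : ℕ) : Prop :=
  ∀ α ∈ F, ∀ β ∈ F, ∀ n, m ≤ n → n ∈ A α → n ∈ A β → α = β

variable {A}

theorem Separates.mono {F G : Finset OmegaOne} {m k : ℕ} (h : Separates A F m) (hG : G ⊆ F)
    (hk : m ≤ k) : Separates A G k :=
  fun α hα β hβ n hn => h α (hG hα) β (hG hβ) n (hk.trans hn)

theorem exists_separates (hA : IsLuzinGap A) (F : Finset OmegaOne) : ∃ m, Separates A F m := by
  have h : ∀ α β, ∃ m, α ≠ β → ∀ n, m ≤ n → n ∈ A α → n ∉ A β := by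
    intro α β
    by_cases hne : α = β
    · exact ⟨0, fun h => (h hne).elim⟩
    · obtain ⟨m, hm⟩ := (hA.almost_disjoint α β hne).bddAbove
      refine ⟨m + 1, fun _ n hn h1 h2 => ?_⟩
      have := hm ⟨h1, h2⟩
      omega
  choose f hf using h
  refine ⟨(F ×ˢ F).sup fun q => f q.1 q.2, fun α hα β hβ n hn h1 h2 => ?_⟩
  by_contra hne
  refine hf α β hne n (le_trans ?_ hn) h1 h2
  exact Finset.le_sup (f := fun q : OmegaOne × OmegaOne => f q.1 q.2)
    (Finset.mk_mem_product hα hβ)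

variable (A) in
/-- Linear combinations of the sequences `pElement (A α)`. -/
noncomputable def comb : (OmegaOne →₀ ℂ) →ₗ[ℂ] LInftyM2 :=
  Finsupp.linearCombination ℂ fun α => pElement (A α)

theorem comb_apply (c : OmegaOne →₀ ℂ) (n : ℕ) :
    comb A c n = ∑ α ∈ c.support, c α • pElement (A α) n := by
  rw [comb, Finsupp.linearCombination_apply, Finsupp.sum, lp.coeFn_sum, Finset.sum_apply]
  rfl

theorem comb_single (α : OmegaOne) (z : ℂ) :
    comb A (Finsupp.single α z) = z • pElement (A α) := by
  rw [comb, Finsupp.linearCombination_single]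

theorem comb_apply_of_mem {F : Finset OmegaOne} {m : ℕ} (hF : Separates A F m)
    {c : OmegaOne →₀ ℂ} (hc : c.support ⊆ F) {n : ℕ} (hn : m ≤ n) {α : OmegaOne} (hα : α ∈ F)
    (hnα : n ∈ A α) : comb A c n = c α • pMatrix (cantorPoint (A α)) := by
  rw [comb_apply, Finset.sum_eq_single α]
  · rw [pElement_of_mem hnα]
  · intro β hβ hne
    rw [pElement_of_notMem, smul_zero]
    exact fun h => hne (hF β (hc hβ) α hα n hn h hnα)
  · intro h
    rw [Finsupp.notMem_support_iff.1 h, zero_smul]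

theorem comb_apply_of_notMem {F : Finset OmegaOne} {c : OmegaOne →₀ ℂ} (hc : c.support ⊆ F)
    {n : ℕ} (hn : ∀ α ∈ F, n ∉ A α) : comb A c n = 0 := by
  rw [comb_apply]
  refine Finset.sum_eq_zero fun α hα => ?_
  rw [pElement_of_notMem (hn α (hc hα)), smul_zero]

variable (A) in
/-- The sequence `z • 1 + comb A c`. -/
noncomputable def unitComb (z : ℂ) (c : OmegaOne →₀ ℂ) : LInftyM2 := z • 1 + comb A c

theorem unitComb_apply (z : ℂ) (c : OmegaOne →₀ ℂ) (n : ℕ) :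
    unitComb A z c n = z • 1 + comb A c n := rfl

/-- Beyond `m` at most one idempotent `p` is present at each coordinate, so this is `(z + c p)(w + d
p) = zw + (zd + wc + cd) p`. -/
theorem unitComb_mul_apply {F : Finset OmegaOne} {m : ℕ} (hF : Separates A F m)
    {c d e : OmegaOne →₀ ℂ} (hc : c.support ⊆ F) (hd : d.support ⊆ F) (he : e.support ⊆ F)
    (z w : ℂ) (h : ∀ α ∈ F, e α = z * d α + w * c α + c α * d α) {n : ℕ} (hn : m ≤ n) :
    unitComb A z c n * unitComb A w d n = unitComb A (z * w) e n := by
  simp only [unitComb_apply]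
  by_cases hex : ∃ α ∈ F, n ∈ A α
  · obtain ⟨α, hα, hnα⟩ := hex
    rw [comb_apply_of_mem hF hc hn hα hnα, comb_apply_of_mem hF hd hn hα hnα,
      comb_apply_of_mem hF he hn hα hnα, h α hα]
    simp only [add_mul, mul_add, smul_mul_smul_comm, mul_one, one_mul, pMatrix_mul, add_smul]
    rw [mul_comm (c α) w]
    abel
  · push Not at hex
    rw [comb_apply_of_notMem hc hex, comb_apply_of_notMem hd hex, comb_apply_of_notMem he hex]
    simp [smul_smul, mul_comm]

end

/-! ### The representation of `⨁ ℤ/2` in the corona -/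

/-- The coefficients of the product of the involutions over the support of `g`. -/
noncomputable def signCoeff (g : OmegaOne →₀ ZMod 2) : OmegaOne →₀ ℂ :=
  g.mapRange (fun z => if z = 0 then 0 else -2) (by simp)

theorem signCoeff_apply (g : OmegaOne →₀ ZMod 2) (α : OmegaOne) :
    signCoeff g α = if g α = 0 then 0 else -2 := rfl

theorem signCoeff_support (g : OmegaOne →₀ ZMod 2) : (signCoeff g).support ⊆ g.support :=
  Finsupp.support_mapRange

/-- The coefficient `-2` comes from `w = 1 - 2p`; where `g` and `h` are both nonzero, `-2 - 2 + 4 =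
0` expresses that `w` is an involution. -/
theorem signCoeff_add (g h : OmegaOne →₀ ZMod 2) (α : OmegaOne) :
    signCoeff (g + h) α =
      1 * signCoeff h α + 1 * signCoeff g α + signCoeff g α * signCoeff h α := by
  simp only [signCoeff_apply, Finsupp.add_apply]
  have h2 : ∀ x : ZMod 2, x = 0 ∨ x = 1 := by decide
  have h3 : (1 : ZMod 2) + 1 = 0 := by decide
  rcases h2 (g α) with ha | ha <;> rcases h2 (h α) with hb | hb <;> (simp [ha, hb, h3]; try norm_num)

theorem signCoeff_zero : signCoeff 0 = 0 := by
  ext α; simp [signCoeff_apply]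

theorem signCoeff_single (α : OmegaOne) :
    signCoeff (Finsupp.single α 1) = Finsupp.single α (-2) := by
  rw [signCoeff, Finsupp.mapRange_single]
  simp

/-- A common bound for the involutions. -/
noncomputable def sBound : ℝ := ‖(1 : M2)‖ + 2 * pBound

section

variable {A : OmegaOne → Set ℕ}

theorem unitComb_signCoeff_mul {F : Finset OmegaOne} {m : ℕ} (hF : Separates A F m)
    {g h : OmegaOne →₀ ZMod 2} (hg : g.support ⊆ F) (hh : h.support ⊆ F) {n : ℕ} (hn : m ≤ n) :
    unitComb A 1 (signCoeff (g + h)) n =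
      unitComb A 1 (signCoeff g) n * unitComb A 1 (signCoeff h) n := by
  classical
  rw [unitComb_mul_apply hF ((signCoeff_support g).trans hg) ((signCoeff_support h).trans hh)
    ((signCoeff_support (g + h)).trans (Finsupp.support_add.trans (Finset.union_subset hg hh)))
    1 1 (fun α _ => signCoeff_add g h α) hn, one_mul]

/-- At most one involution is active at each late coordinate, so the bound does not depend on `g`.
-/
theorem norm_unitComb_signCoeff_le {F : Finset OmegaOne} {m : ℕ} (hF : Separates A F m)
    {g : OmegaOne →₀ ZMod 2} (hg : g.support ⊆ F) {n : ℕ} (hn : m ≤ n) :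
    ‖unitComb A 1 (signCoeff g) n‖ ≤ sBound := by
  have hp := pBound_nonneg
  have hc := (signCoeff_support g).trans hg
  rw [unitComb_apply, one_smul, sBound]
  refine (norm_add_le _ _).trans (add_le_add le_rfl ?_)
  by_cases hex : ∃ α ∈ F, n ∈ A α
  · obtain ⟨α, hα, hnα⟩ := hex
    rw [comb_apply_of_mem hF hc hn hα hnα, norm_smul]
    gcongr
    · rw [signCoeff_apply]
      split_ifs <;> simp
    · exact norm_pMatrix_le (abs_cantorPoint_le _)
  · push Not at hex
    rw [comb_apply_of_notMem hc hex, norm_zero]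
    positivity

variable (A) in
/-- The uniformly bounded representation attached to an almost disjoint family. -/
noncomputable def luzinRep (g : Multiplicative (OmegaOne →₀ ZMod 2)) : CoronaM2 :=
  coronaQ (unitComb A 1 (signCoeff g.toAdd))

theorem unitComb_zero (z : ℂ) : unitComb A z 0 = z • 1 := by
  rw [unitComb, map_zero, add_zero]

theorem luzinRep_one : luzinRep A 1 = 1 := by
  rw [luzinRep, toAdd_one, signCoeff_zero, unitComb_zero, one_smul, coronaQ_one]

theorem luzinRep_single (α : OmegaOne) :
    luzinRep A (Multiplicative.ofAdd (Finsupp.single α 1)) = coronaQ (wElement (A α)) := by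
  rw [luzinRep, toAdd_ofAdd, signCoeff_single, unitComb, comb_single, wElement_eq, one_smul,
    neg_smul, sub_eq_add_neg]

theorem luzinRep_mul (hA : IsLuzinGap A) (g h : Multiplicative (OmegaOne →₀ ZMod 2)) :
    luzinRep A (g * h) = luzinRep A g * luzinRep A h := by
  classical
  obtain ⟨m, hm⟩ := exists_separates hA (g.toAdd.support ∪ h.toAdd.support)
  rw [luzinRep, luzinRep, luzinRep, ← coronaQ_mul]
  refine coronaQ_eq_of_eventuallyEq (eventually_atTop.2 ⟨m, fun n hn => ?_⟩)
  rw [lp.infty_coeFn_mul, Pi.mul_apply, toAdd_mul]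
  exact unitComb_signCoeff_mul hm Finset.subset_union_left Finset.subset_union_right hn

theorem isUniformlyBoundedRep_luzinRep (hA : IsLuzinGap A) :
    IsUniformlyBoundedRep (luzinRep A) where
  map_mul := luzinRep_mul hA
  isUnit g := by
    have h : ∀ a b : Multiplicative (OmegaOne →₀ ZMod 2), a * b = 1 →
        luzinRep A a * luzinRep A b = 1 := fun a b hab => by
      rw [← luzinRep_mul hA, hab, luzinRep_one]
    exact ⟨⟨luzinRep A g, luzinRep A g⁻¹, h _ _ (mul_inv_cancel g), h _ _ (inv_mul_cancel g)⟩, rfl⟩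
  bounded := by
    refine ⟨sBound, fun g => norm_coronaQ_le ?_⟩
    obtain ⟨m, hm⟩ := exists_separates hA g.toAdd.support
    exact eventually_atTop.2 ⟨m, fun n hn => norm_unitComb_signCoeff_le hm subset_rfl hn⟩

/-! ### The algebra -/

theorem unitComb_add (z w : ℂ) (c d : OmegaOne →₀ ℂ) :
    unitComb A (z + w) (c + d) = unitComb A z c + unitComb A w d := by
  rw [unitComb, unitComb, unitComb, map_add, add_smul]
  abel

theorem unitComb_smul (r z : ℂ) (c : OmegaOne →₀ ℂ) :
    unitComb A (r * z) (r • c) = r • unitComb A z c := by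
  rw [unitComb, unitComb, map_smul, smul_add, smul_smul]

theorem eventually_unitComb_mul (hA : IsLuzinGap A) (z w : ℂ) (c d : OmegaOne →₀ ℂ) :
    ∃ e, ∀ᶠ n in atTop, unitComb A z c n * unitComb A w d n = unitComb A (z * w) e n := by
  classical
  set e : OmegaOne →₀ ℂ := z • d + w • c + c * d
  obtain ⟨m, hm⟩ := exists_separates hA (c.support ∪ d.support ∪ e.support)
  refine ⟨e, eventually_atTop.2 ⟨m, fun n hn => ?_⟩⟩
  refine unitComb_mul_apply hm ?_ ?_ ?_ z w (fun α _ => by simp [e]) hn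
  · exact Finset.subset_union_left.trans Finset.subset_union_left
  · exact Finset.subset_union_right.trans Finset.subset_union_left
  · exact Finset.subset_union_right

variable (A) in
/-- The set of bounded sequences that are limits, modulo `c₀`, of the sequences `unitComb A z c`. -/
def luzinSet : Set LInftyM2 :=
  {x | ∀ ε > (0 : ℝ), ∃ z c, ∀ᶠ n in atTop, ‖x n - unitComb A z c n‖ ≤ ε}

theorem unitComb_mem_luzinSet (z : ℂ) (c : OmegaOne →₀ ℂ) : unitComb A z c ∈ luzinSet A :=
  fun ε hε => ⟨z, c, Eventually.of_forall fun n => by simpa using hε.le⟩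

theorem add_mem_luzinSet {x y : LInftyM2} (hx : x ∈ luzinSet A) (hy : y ∈ luzinSet A) :
    x + y ∈ luzinSet A := by
  intro ε hε
  obtain ⟨z, c, h1⟩ := hx (ε / 2) (by positivity)
  obtain ⟨w, d, h2⟩ := hy (ε / 2) (by positivity)
  refine ⟨z + w, c + d, ?_⟩
  filter_upwards [h1, h2] with n hn1 hn2
  rw [unitComb_add, lp.coeFn_add, lp.coeFn_add, Pi.add_apply, Pi.add_apply, add_sub_add_comm]
  exact (norm_add_le _ _).trans (by linarith)

theorem mul_mem_luzinSet (hA : IsLuzinGap A) {x y : LInftyM2} (hx : x ∈ luzinSet A)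
    (hy : y ∈ luzinSet A) : x * y ∈ luzinSet A := by
  intro ε hε
  -- The `+ 1` keeps the denominators positive; the second tolerance depends on the approximant `u`
  -- of `x`.
  obtain ⟨z, c, h1⟩ := hx (ε / (2 * (‖y‖ + 1))) (by positivity)
  set u := unitComb A z c
  obtain ⟨w, d, h2⟩ := hy (ε / (2 * (‖u‖ + 1))) (by positivity)
  set v := unitComb A w d
  obtain ⟨e, he⟩ := eventually_unitComb_mul hA z w c d
  refine ⟨z * w, e, ?_⟩
  filter_upwards [h1, h2, he] with n hn1 hn2 hn3
  rw [← hn3, lp.infty_coeFn_mul, Pi.mul_apply]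
  have hsplit : x n * y n - u n * v n = (x n - u n) * y n + u n * (y n - v n) := by noncomm_ring
  have hy' : ‖y n‖ ≤ ‖y‖ + 1 :=
    (lp.norm_apply_le_norm ENNReal.top_ne_zero y n).trans (by linarith)
  have hu' : ‖u n‖ ≤ ‖u‖ + 1 :=
    (lp.norm_apply_le_norm ENNReal.top_ne_zero u n).trans (by linarith)
  have hy0 := norm_nonneg y
  have hu0 := norm_nonneg u
  calc ‖x n * y n - u n * v n‖ ≤ ‖(x n - u n) * y n‖ + ‖u n * (y n - v n)‖ := by
        rw [hsplit]; exact norm_add_le _ _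
    _ ≤ ‖x n - u n‖ * ‖y n‖ + ‖u n‖ * ‖y n - v n‖ :=
        add_le_add (norm_mul_le _ _) (norm_mul_le _ _)
    _ ≤ ε / (2 * (‖y‖ + 1)) * (‖y‖ + 1) + (‖u‖ + 1) * (ε / (2 * (‖u‖ + 1))) := by
        gcongr
    _ = ε := by field_simp; norm_num

/-- The algebra attached to a Luzin gap. -/
noncomputable def luzinAlgebra (hA : IsLuzinGap A) : Subalgebra ℂ LInftyM2 where
  carrier := luzinSet A
  mul_mem' := mul_mem_luzinSet hA
  add_mem' := add_mem_luzinSet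
  algebraMap_mem' r := by
    rw [Algebra.algebraMap_eq_smul_one, ← unitComb_zero (A := A)]
    exact unitComb_mem_luzinSet r 0

theorem isClosed_luzinSet : IsClosed (luzinSet A) := by
  refine isClosed_of_closure_subset fun x hx ε hε => ?_
  obtain ⟨y, hy, hxy⟩ := Metric.mem_closure_iff.1 hx (ε / 2) (by positivity)
  obtain ⟨z, c, h⟩ := hy (ε / 2) (by positivity)
  refine ⟨z, c, ?_⟩
  filter_upwards [h] with n hn
  have h1 : ‖x n - y n‖ ≤ ε / 2 :=
    (lp.norm_apply_le_norm ENNReal.top_ne_zero (x - y) n).trans (by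
      rw [← dist_eq_norm]; exact hxy.le)
  calc ‖x n - unitComb A z c n‖ = ‖(x n - y n) + (y n - unitComb A z c n)‖ := by
        rw [sub_add_sub_cancel]
    _ ≤ ε / 2 + ε / 2 := (norm_add_le _ _).trans (add_le_add h1 hn)
    _ = ε := by ring

theorem span_range_luzinRep :
    (Submodule.span ℂ (Set.range (luzinRep A)) : Set CoronaM2) =
      {y | ∃ z c, y = coronaQ (unitComb A z c)} := by
  apply Set.Subset.antisymm
  · intro y hy
    induction hy using Submodule.span_induction with
    | mem y hy =>
      obtain ⟨g, rfl⟩ := hy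
      exact ⟨1, _, rfl⟩
    | zero => exact ⟨0, 0, by rw [unitComb_zero, zero_smul, coronaQ_zero]⟩
    | add y y' _ _ h h' =>
      obtain ⟨z, c, rfl⟩ := h
      obtain ⟨w, d, rfl⟩ := h'
      exact ⟨z + w, c + d, by rw [unitComb_add, coronaQ_add]⟩
    | smul r y _ h =>
      obtain ⟨z, c, rfl⟩ := h
      exact ⟨r * z, r • c, by rw [unitComb_smul, coronaQ_smul]⟩
  · rintro _ ⟨z, c, rfl⟩
    have h1 : (1 : CoronaM2) ∈ Submodule.span ℂ (Set.range (luzinRep A)) :=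
      Submodule.subset_span ⟨1, luzinRep_one⟩
    have h2 : ∀ α, coronaQ (pElement (A α)) ∈ Submodule.span ℂ (Set.range (luzinRep A)) := by
      intro α
      have hw : coronaQ (wElement (A α)) ∈ Submodule.span ℂ (Set.range (luzinRep A)) :=
        Submodule.subset_span ⟨_, luzinRep_single α⟩
      have : pElement (A α) = (1 / 2 : ℂ) • (1 - wElement (A α)) := by
        rw [wElement_eq, sub_sub_cancel, smul_smul]
        norm_num
      rw [this, coronaQ_smul, coronaQ_sub, coronaQ_one]
      exact Submodule.smul_mem _ _ (Submodule.sub_mem _ h1 hw)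
    have h3 : ∀ c, coronaQ (comb A c) ∈ Submodule.span ℂ (Set.range (luzinRep A)) := by
      intro c
      induction c using Finsupp.induction_linear with
      | zero => rw [map_zero, coronaQ_zero]; exact Submodule.zero_mem _
      | add c d hc hd => rw [map_add, coronaQ_add]; exact Submodule.add_mem _ hc hd
      | single α z => rw [comb_single, coronaQ_smul]; exact Submodule.smul_mem _ _ (h2 α)
    rw [unitComb, coronaQ_add, coronaQ_smul, coronaQ_one]
    exact Submodule.add_mem _ (Submodule.smul_mem _ _ h1) (h3 c)

theorem norm_coronaQ_sub_le {x y : LInftyM2} {C : ℝ} (h : ∀ᶠ n in atTop, ‖x n - y n‖ ≤ C) :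
    ‖coronaQ x - coronaQ y‖ ≤ C := by
  rw [← coronaQ_sub]
  exact norm_coronaQ_le (x := x - y) h

theorem eventually_norm_sub_le {x y : LInftyM2} {ε : ℝ} (h : ‖coronaQ x - coronaQ y‖ < ε) :
    ∀ᶠ n in atTop, ‖x n - y n‖ ≤ ε := by
  rw [← coronaQ_sub] at h
  exact eventually_norm_le_of_norm_coronaQ_lt (x := x - y) h

theorem luzinSet_eq_preimage : luzinSet A =
    coronaQ ⁻¹' closure (Submodule.span ℂ (Set.range (luzinRep A)) : Set CoronaM2) := by
  rw [span_range_luzinRep]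
  ext x
  rw [Set.mem_preimage, SeminormedAddCommGroup.mem_closure_iff]
  constructor
  · intro hx ε hε
    obtain ⟨z, c, h⟩ := hx (ε / 2) (by positivity)
    exact ⟨coronaQ (unitComb A z c), ⟨z, c, rfl⟩, (norm_coronaQ_sub_le h).trans_lt (by linarith)⟩
  · intro hx ε hε
    obtain ⟨y, ⟨z, c, hy⟩, h⟩ := hx ε hε
    subst hy
    exact ⟨z, c, eventually_norm_sub_le h⟩

end

/-! ### A finite group that spans `M₂` -/

/-- The signed permutation matrices. -/
abbrev SignedPerm : Type := Matrix.orthogonalGroup (Fin 2) ℤ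

theorem SignedPerm.entry_mem (p : SignedPerm) (i j : Fin 2) :
    (p : Matrix (Fin 2) (Fin 2) ℤ) i j ∈ Set.Icc (-1 : ℤ) 1 := by
  have h := (Matrix.mem_orthogonalGroup_iff (Fin 2) ℤ).1 p.2
  have hi := congrFun (congrFun h i) i
  rw [Matrix.mul_apply, Fin.sum_univ_two, Matrix.one_apply_eq] at hi
  simp only [Matrix.transpose_apply] at hi
  rw [Set.mem_Icc]
  fin_cases j <;> simp only [Fin.zero_eta, Fin.mk_one] <;> constructor <;> nlinarith

instance SignedPerm.instFinite : Finite SignedPerm := by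
  refine Finite.of_injective (β := Fin 2 → Fin 2 → Set.Icc (-1 : ℤ) 1)
    (fun p i j => ⟨_, p.entry_mem i j⟩) fun p q h => ?_
  ext i j
  exact congrArg Subtype.val (congrFun (congrFun h i) j)

/-- Signed permutation matrices as complex matrices. -/
noncomputable def SignedPerm.toM2 : SignedPerm →* M2 :=
  ((Int.castRingHom ℂ).mapMatrix : Matrix (Fin 2) (Fin 2) ℤ →+* M2).toMonoidHom.comp
    (Matrix.orthogonalGroup (Fin 2) ℤ).subtype

theorem SignedPerm.toM2_apply (p : SignedPerm) (i j : Fin 2) :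
    p.toM2 i j = ((p : Matrix (Fin 2) (Fin 2) ℤ) i j : ℂ) := rfl

theorem SignedPerm.toM2_neg (p : SignedPerm) : (-p).toM2 = -p.toM2 := by
  ext i j
  rw [Matrix.neg_apply, SignedPerm.toM2_apply, SignedPerm.toM2_apply]
  exact Int.cast_neg _

theorem SignedPerm.exists_bound : ∃ C : ℝ, ∀ p : SignedPerm, ‖p.toM2‖ ≤ C := by
  obtain ⟨C, hC⟩ := (Set.finite_range fun p : SignedPerm => ‖p.toM2‖).bddAbove
  exact ⟨C, fun p => hC ⟨p, rfl⟩⟩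

/-- The identity, a reflection, the swap and a quarter turn suffice. Spanning makes every value at
an initial coordinate available to the finite groups below. -/
theorem SignedPerm.span_eq_top : Submodule.span ℂ (Set.range SignedPerm.toM2) = ⊤ := by
  have key : ∀ M : Matrix (Fin 2) (Fin 2) ℤ, M * M.transpose = 1 →
      M.map (fun k : ℤ => (k : ℂ)) ∈ Submodule.span ℂ (Set.range SignedPerm.toM2) :=
    fun M hM => Submodule.subset_span ⟨⟨M, (Matrix.mem_orthogonalGroup_iff (Fin 2) ℤ).2 hM⟩, rfl⟩
  have h1 := key !![1, 0; 0, 1] (by decide)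
  have h2 := key !![1, 0; 0, -1] (by decide)
  have h3 := key !![0, 1; 1, 0] (by decide)
  have h4 := key !![0, 1; -1, 0] (by decide)
  rw [eq_top_iff]
  intro M _
  have : M = ((M 0 0 + M 1 1) / 2) • (!![1, 0; 0, 1] : Matrix (Fin 2) (Fin 2) ℤ).map
        (fun k : ℤ => (k : ℂ)) +
      ((M 0 0 - M 1 1) / 2) • (!![1, 0; 0, -1] : Matrix (Fin 2) (Fin 2) ℤ).map
        (fun k : ℤ => (k : ℂ)) +
      ((M 0 1 + M 1 0) / 2) • (!![0, 1; 1, 0] : Matrix (Fin 2) (Fin 2) ℤ).map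
        (fun k : ℤ => (k : ℂ)) +
      ((M 0 1 - M 1 0) / 2) • (!![0, 1; -1, 0] : Matrix (Fin 2) (Fin 2) ℤ).map
        (fun k : ℤ => (k : ℂ)) := by
    ext i j
    fin_cases i <;> fin_cases j <;> simp <;> ring
  rw [this]
  exact Submodule.add_mem _ (Submodule.add_mem _ (Submodule.add_mem _ (Submodule.smul_mem _ _ h1)
    (Submodule.smul_mem _ _ h2)) (Submodule.smul_mem _ _ h3)) (Submodule.smul_mem _ _ h4)

/-! ### Finite groups in the algebra of a Luzin gap -/

/-- The elements of `⨁ ℤ/2` that are supported on a finite set. -/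
def supportedSubgroup (F : Finset OmegaOne) : Subgroup (Multiplicative (OmegaOne →₀ ZMod 2)) where
  carrier := {g | g.toAdd.support ⊆ F}
  mul_mem' {g h} hg hh := by
    classical
    exact Finsupp.support_add.trans (Finset.union_subset hg hh)
  one_mem' := by
    change (0 : OmegaOne →₀ ZMod 2).support ⊆ F
    simp
  inv_mem' {g} hg := by
    change (-g.toAdd).support ⊆ F
    rwa [Finsupp.support_neg]

theorem mem_supportedSubgroup {F : Finset OmegaOne} {g : Multiplicative (OmegaOne →₀ ZMod 2)} :
    g ∈ supportedSubgroup F ↔ g.toAdd.support ⊆ F := Iff.rfl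

instance supportedSubgroup_finite (F : Finset OmegaOne) : Finite (supportedSubgroup F) := by
  refine Finite.of_injective (β := F → ZMod 2) (fun g α => g.1.toAdd α) fun g h hgh => ?_
  apply Subtype.ext
  apply Multiplicative.toAdd.injective
  ext α
  by_cases hα : α ∈ F
  · exact congrFun hgh ⟨α, hα⟩
  · rw [Finsupp.notMem_support_iff.1 fun h' => hα (g.2 h'),
      Finsupp.notMem_support_iff.1 fun h' => hα (h.2 h')]

section

variable {A : OmegaOne → Set ℕ}

/-- The finite group consisting of blocks of signed permutations on `[0, m)`, followed by the
involutions given by elements supported on `F`. -/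
abbrev BlockGroup (F : Finset OmegaOne) (m : ℕ) : Type :=
  (Fin m → SignedPerm) × supportedSubgroup F

variable (A) in
/-- The coordinates of the sequence given by an element of the block group. -/
noncomputable def blockFun {F : Finset OmegaOne} {m : ℕ} (q : BlockGroup F m) (n : ℕ) : M2 :=
  if h : n < m then (q.1 ⟨n, h⟩).toM2 else unitComb A 1 (signCoeff q.2.1.toAdd) n

theorem blockFun_of_lt {F : Finset OmegaOne} {m : ℕ} (q : BlockGroup F m) {n : ℕ} (h : n < m) :
    blockFun A q n = (q.1 ⟨n, h⟩).toM2 := dif_pos h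

theorem blockFun_of_le {F : Finset OmegaOne} {m : ℕ} (q : BlockGroup F m) {n : ℕ} (h : m ≤ n) :
    blockFun A q n = unitComb A 1 (signCoeff q.2.1.toAdd) n := dif_neg (not_lt.2 h)

theorem norm_blockFun_le {C : ℝ} (hC : ∀ p : SignedPerm, ‖p.toM2‖ ≤ C) {F : Finset OmegaOne}
    {m : ℕ} (hF : Separates A F m) (q : BlockGroup F m) (n : ℕ) :
    ‖blockFun A q n‖ ≤ max C sBound := by
  rcases lt_or_ge n m with h | h
  · rw [blockFun_of_lt q h]
    exact (hC _).trans (le_max_left _ _)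
  · rw [blockFun_of_le q h]
    exact (norm_unitComb_signCoeff_le hF q.2.2 h).trans (le_max_right _ _)

/-- The representation of the block group by bounded sequences. -/
noncomputable def blockRep {F : Finset OmegaOne} {m : ℕ} (hF : Separates A F m) :
    BlockGroup F m →* LInftyM2 where
  toFun q := ⟨blockFun A q, memℓp_infty (by
    obtain ⟨C, hC⟩ := SignedPerm.exists_bound
    refine ⟨max C sBound, ?_⟩
    rintro _ ⟨n, rfl⟩
    exact norm_blockFun_le hC hF q n)⟩
  map_one' := by
    ext1
    funext n
    change blockFun A 1 n = 1
    rcases lt_or_ge n m with h | h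
    · rw [blockFun_of_lt _ h]
      exact map_one SignedPerm.toM2
    · rw [blockFun_of_le _ h]
      change unitComb A 1 (signCoeff 0) n = 1
      rw [signCoeff_zero, unitComb_zero, one_smul]
      rfl
  map_mul' q r := by
    ext1
    funext n
    change blockFun A (q * r) n = blockFun A q n * blockFun A r n
    rcases lt_or_ge n m with h | h
    · simp only [blockFun_of_lt _ h]
      exact map_mul SignedPerm.toM2 _ _
    · simp only [blockFun_of_le _ h]
      exact unitComb_signCoeff_mul hF q.2.2 r.2.2 h

theorem blockRep_apply {F : Finset OmegaOne} {m : ℕ} (hF : Separates A F m) (q : BlockGroup F m)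
    (n : ℕ) : blockRep hF q n = blockFun A q n := rfl

theorem blockRep_mem_luzinSet {F : Finset OmegaOne} {m : ℕ} (hF : Separates A F m)
    (q : BlockGroup F m) : blockRep hF q ∈ luzinSet A := by
  intro ε hε
  refine ⟨1, signCoeff q.2.1.toAdd, eventually_atTop.2 ⟨m, fun n hn => ?_⟩⟩
  rw [blockRep_apply, blockFun_of_le q hn, sub_self, norm_zero]
  exact hε.le

/-- Changing the sign of one block and subtracting cancels all other coordinates; here `-p` is again
a signed permutation. -/
theorem single_mem_span_blockRep {F : Finset OmegaOne} {m : ℕ} (hF : Separates A F m) {n : ℕ}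
    (hn : n < m) (M : M2) :
    lp.single ∞ n M ∈ Submodule.span ℂ (Set.range (blockRep hF)) := by
  classical
  have hM : M ∈ Submodule.span ℂ (Set.range SignedPerm.toM2) := by
    rw [SignedPerm.span_eq_top]
    exact Submodule.mem_top
  induction hM using Submodule.span_induction with
  | mem M hM =>
    obtain ⟨p, rfl⟩ := hM
    have h : ∀ s : SignedPerm, blockRep hF (Function.update 1 ⟨n, hn⟩ s, 1) ∈
        Submodule.span ℂ (Set.range (blockRep hF)) := fun s => Submodule.subset_span ⟨_, rfl⟩
    have heq : lp.single ∞ n p.toM2 = (1 / 2 : ℂ) •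
        (blockRep hF (Function.update 1 ⟨n, hn⟩ p, 1) -
          blockRep hF (Function.update 1 ⟨n, hn⟩ (-p), 1)) := by
      ext1
      funext k
      rw [lp.coeFn_smul, Pi.smul_apply, lp.coeFn_sub, Pi.sub_apply, blockRep_apply, blockRep_apply]
      rcases eq_or_ne k n with rfl | hk
      · rw [lp.single_apply_self, blockFun_of_lt _ hn, blockFun_of_lt _ hn]
        simp only [Function.update_self]
        rw [SignedPerm.toM2_neg, sub_neg_eq_add, ← two_smul ℂ, smul_smul]
        norm_num
      · rw [lp.single_apply_ne _ _ _ hk]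
        rcases lt_or_ge k m with h' | h'
        · rw [blockFun_of_lt _ h', blockFun_of_lt _ h']
          have : (⟨k, h'⟩ : Fin m) ≠ ⟨n, hn⟩ := fun h => hk (congrArg Fin.val h)
          simp [Function.update_of_ne this]
        · rw [blockFun_of_le _ h', blockFun_of_le _ h']
          simp
    rw [heq]
    exact Submodule.smul_mem _ _ (Submodule.sub_mem _ (h p) (h (-p)))
  | zero => rw [lp.single_zero]; exact Submodule.zero_mem _
  | add M N _ _ hM hN => rw [lp.single_add]; exact Submodule.add_mem _ hM hN
  | smul c M _ hM => rw [lp.single_smul]; exact Submodule.smul_mem _ _ hM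

theorem mem_span_blockRep_of_support {F : Finset OmegaOne} {m : ℕ} (hF : Separates A F m)
    {x : LInftyM2} (hx : ∀ n, m ≤ n → x n = 0) :
    x ∈ Submodule.span ℂ (Set.range (blockRep hF)) := by
  classical
  have : x = ∑ n ∈ Finset.range m, lp.single ∞ n (x n) := by
    ext1
    funext k
    rw [lp.coeFn_sum, Finset.sum_apply]
    rcases lt_or_ge k m with h | h
    · rw [Finset.sum_eq_single_of_mem k (Finset.mem_range.2 h), lp.single_apply_self]
      intro n _ hn
      exact lp.single_apply_ne _ _ _ hn.symm
    · rw [hx k h, Finset.sum_eq_zero]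
      intro n hn
      have := Finset.mem_range.1 hn
      exact lp.single_apply_ne _ _ _ (by omega)
  rw [this]
  exact Submodule.sum_mem _ fun n hn => single_mem_span_blockRep hF (Finset.mem_range.1 hn) _

/-- The coordinates below `m` are arbitrary within the span, so only the tail matters, and there `p
= (1 - w) / 2`. -/
theorem mem_span_blockRep {F : Finset OmegaOne} {m : ℕ} (hF : Separates A F m)
    {x : LInftyM2} {z : ℂ} {c : OmegaOne →₀ ℂ} (hc : c.support ⊆ F)
    (hx : ∀ n, m ≤ n → x n = unitComb A z c n) :
    x ∈ Submodule.span ℂ (Set.range (blockRep hF)) := by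
  set S := Submodule.span ℂ (Set.range (blockRep hF))
  have hcongr : ∀ {x y : LInftyM2}, y ∈ S → (∀ n, m ≤ n → x n = y n) → x ∈ S := by
    intro x y hy hxy
    have : x - y ∈ S := mem_span_blockRep_of_support hF fun n hn => by
      rw [lp.coeFn_sub, Pi.sub_apply, hxy n hn, sub_self]
    simpa using Submodule.add_mem _ this hy
  have hone : (1 : LInftyM2) ∈ S := Submodule.subset_span ⟨1, map_one _⟩
  have hp : ∀ α ∈ F, pElement (A α) ∈ S := by
    intro α hα
    have hmem : Multiplicative.ofAdd (Finsupp.single α (1 : ZMod 2)) ∈ supportedSubgroup F := by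
      rw [mem_supportedSubgroup, toAdd_ofAdd]
      exact Finsupp.support_single_subset.trans (Finset.singleton_subset_iff.2 hα)
    have h1 : blockRep hF (1, ⟨_, hmem⟩) ∈ S := Submodule.subset_span ⟨_, rfl⟩
    have h2 : wElement (A α) ∈ S := by
      refine hcongr h1 fun n hn => ?_
      rw [blockRep_apply, blockFun_of_le _ hn, toAdd_ofAdd, signCoeff_single, unitComb,
        comb_single, wElement_eq, one_smul, neg_smul, sub_eq_add_neg]
    have h3 : pElement (A α) = (1 / 2 : ℂ) • (1 - wElement (A α)) := by
      rw [wElement_eq, sub_sub_cancel, smul_smul]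
      norm_num
    rw [h3]
    exact Submodule.smul_mem _ _ (Submodule.sub_mem _ hone h2)
  refine hcongr ?_ hx
  rw [unitComb, comb, Finsupp.linearCombination_apply, Finsupp.sum]
  refine Submodule.add_mem _ (Submodule.smul_mem _ _ hone) (Submodule.sum_mem _ fun α hα => ?_)
  exact Submodule.smul_mem _ _ (hp α (hc hα))

theorem exists_eventuallyEq_near {x : LInftyM2} (hx : x ∈ luzinSet A) {ε : ℝ} (hε : 0 < ε) :
    ∃ (y : LInftyM2) (z : ℂ) (c : OmegaOne →₀ ℂ),
      (∀ᶠ n in atTop, y n = unitComb A z c n) ∧ ‖x - y‖ ≤ ε := by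
  obtain ⟨z, c, h⟩ := hx ε hε
  obtain ⟨m, hm⟩ := eventually_atTop.1 h
  refine ⟨x - (x - unitComb A z c).tail m, z, c, eventually_atTop.2 ⟨m, fun n hn => ?_⟩, ?_⟩
  · rw [lp.coeFn_sub, Pi.sub_apply, LInftyM2.tail_of_le _ hn, lp.coeFn_sub, Pi.sub_apply,
      sub_sub_cancel]
  · rw [sub_sub_cancel]
    refine lp.norm_le_of_forall_le hε.le fun n => ?_
    rcases lt_or_ge n m with hn | hn
    · rw [LInftyM2.tail_of_lt _ hn, norm_zero]
      exact hε.le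
    · rw [LInftyM2.tail_of_le _ hn]
      exact hm n hn

theorem isAmenable_luzinAlgebra (hA : IsLuzinGap A) :
    IsAmenableBanachAlgebra (luzinAlgebra hA) := by
  choose μ hμ using fun F => exists_separates hA F
  -- The summand `i.2` pushes the start of the tail past any given place, so that an element is
  -- captured once it agrees with its combination from there on.
  have hsep : ∀ i : Finset OmegaOne × ℕ, Separates A i.1 (μ i.1 + i.2) := fun i =>
    (hμ i.1).mono subset_rfl (Nat.le_add_right _ _)
  obtain ⟨C, hC⟩ := SignedPerm.exists_bound
  let ρ : ∀ i : Finset OmegaOne × ℕ, BlockGroup i.1 (μ i.1 + i.2) →* luzinAlgebra hA := fun i =>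
    (blockRep (hsep i)).codRestrict (luzinAlgebra hA) fun q => blockRep_mem_luzinSet (hsep i) q
  refine isAmenable_of_finite_groups atTop
    (fun i : Finset OmegaOne × ℕ => BlockGroup i.1 (μ i.1 + i.2)) ρ
    (C := max C sBound) ?_
    {a | ∃ z c, ∀ᶠ n in atTop, (a : LInftyM2) n = unitComb A z c n} ?_ ?_
  · intro i q
    refine lp.norm_le_of_forall_le ?_ fun n => norm_blockFun_le hC (hsep i) q n
    exact ((norm_nonneg _).trans (hC 1)).trans (le_max_left _ _)
  · rw [Metric.dense_iff]
    rintro ⟨x, hx⟩ ε hε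
    obtain ⟨y, z, c, hy, hxy⟩ := exists_eventuallyEq_near hx (half_pos hε)
    have hyA : y ∈ luzinSet A := fun δ hδ => ⟨z, c, by
      filter_upwards [hy] with n hn
      rw [hn, sub_self, norm_zero]
      exact hδ.le⟩
    refine ⟨⟨y, hyA⟩, ?_, z, c, hy⟩
    rw [Metric.mem_ball, dist_comm, Subtype.dist_eq, dist_eq_norm]
    exact hxy.trans_lt (half_lt_self hε)
  · rintro a ⟨z, c, h⟩
    obtain ⟨N, hN⟩ := eventually_atTop.1 h
    filter_upwards [eventually_ge_atTop (c.support, N)] with i hi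
    have h1 : (a : LInftyM2) ∈ Submodule.span ℂ (Set.range (blockRep (hsep i))) :=
      mem_span_blockRep (hsep i) hi.1 fun n hn => hN n (hi.2.trans (by omega))
    have h2 : Submodule.map (luzinAlgebra hA).val.toLinearMap
        (Submodule.span ℂ (Set.range (ρ i))) =
        Submodule.span ℂ (Set.range (blockRep (hsep i))) := by
      rw [Submodule.map_span, ← Set.range_comp]
      rfl
    rw [← h2] at h1
    obtain ⟨b, hb, hba⟩ := h1
    rwa [← Subtype.ext (a1 := b) (a2 := a) hba]

end

/-! ### Limits along the members of a Luzin gap -/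

section

variable {A : OmegaOne → Set ℕ}

variable (A) in
/-- The filter of the cofinite subsets of `A α`. -/
def gapFilter (α : OmegaOne) : Filter ℕ := atTop ⊓ 𝓟 (A α)

variable (A) in
/-- The idempotent that is attached to `A α`. -/
noncomputable def gapIdem (α : OmegaOne) : M2 := pMatrix (cantorPoint (A α))

theorem gapIdem_mul_self (α : OmegaOne) : gapIdem A α * gapIdem A α = gapIdem A α :=
  pMatrix_mul _ _

theorem gapFilter_neBot (hA : IsLuzinGap A) (α : OmegaOne) : (gapFilter A α).NeBot := by
  have h := Nat.frequently_atTop_iff_infinite.2 (hA.infinite α)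
  exact frequently_mem_iff_neBot.1 h

theorem eventually_gapFilter {α : OmegaOne} {p : ℕ → Prop} :
    (∀ᶠ n in gapFilter A α, p n) ↔ ∃ m, ∀ n, m ≤ n → n ∈ A α → p n := by
  rw [gapFilter, eventually_inf_principal, eventually_atTop]

theorem eventually_unitComb_eq (hA : IsLuzinGap A) (α : OmegaOne) (z : ℂ) (c : OmegaOne →₀ ℂ) :
    ∀ᶠ n in gapFilter A α, unitComb A z c n = z • 1 + c α • gapIdem A α := by
  classical
  obtain ⟨m, hm⟩ := exists_separates hA (insert α c.support)
  refine eventually_gapFilter.2 ⟨m, fun n hn hnα => ?_⟩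
  rw [unitComb_apply, comb_apply_of_mem hm (Finset.subset_insert _ _) hn
    (Finset.mem_insert_self _ _) hnα, gapIdem]

theorem eventually_norm_sub_gapIdem_le (hA : IsLuzinGap A) (α : OmegaOne) {x : LInftyM2} {z : ℂ}
    {c : OmegaOne →₀ ℂ} {ε : ℝ} (h : ∀ᶠ n in atTop, ‖x n - unitComb A z c n‖ ≤ ε) :
    ∀ᶠ n in gapFilter A α, ‖x n - (z • 1 + c α • gapIdem A α)‖ ≤ ε := by
  filter_upwards [eventually_unitComb_eq hA α z c, h.filter_mono inf_le_left] with n h1 h2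
  rwa [← h1]

/-- Late in `A α` only the `α`-term of a combination survives, so approximants are eventually
constant along the filter, with values in a closed two-dimensional space. That space is a
commutative algebra, which is used for adjoints later. -/
theorem exists_tendsto_gapFilter (hA : IsLuzinGap A) (α : OmegaOne) {x : LInftyM2}
    (hx : x ∈ luzinSet A) :
    ∃ a b : ℂ, Tendsto (fun n => x n) (gapFilter A α) (𝓝 (a • 1 + b • gapIdem A α)) := by
  have hne := gapFilter_neBot hA α
  have hcauchy : Cauchy (map (fun n => x n) (gapFilter A α)) := by
    refine Metric.cauchy_iff.2 ⟨inferInstance, fun ε hε => ?_⟩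
    obtain ⟨z, c, h⟩ := hx (ε / 3) (by positivity)
    refine ⟨Metric.closedBall (z • 1 + c α • gapIdem A α) (ε / 3), ?_, fun M hM N hN => ?_⟩
    · rw [Filter.mem_map]
      filter_upwards [eventually_norm_sub_gapIdem_le hA α h] with n hn
      rwa [Set.mem_preimage, Metric.mem_closedBall, dist_eq_norm]
    · rw [Metric.mem_closedBall] at hM hN
      have := dist_triangle_right M N (z • 1 + c α • gapIdem A α)
      linarith
  obtain ⟨L, hL⟩ := CompleteSpace.complete hcauchy
  have hLW : L ∈ Submodule.span ℂ {(1 : M2), gapIdem A α} := by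
    have hcl : IsClosed (Submodule.span ℂ {(1 : M2), gapIdem A α} : Set M2) :=
      Submodule.closed_of_finiteDimensional _
    rw [← SetLike.mem_coe, ← hcl.closure_eq, Metric.mem_closure_iff]
    intro ε hε
    obtain ⟨z, c, h⟩ := hx (ε / 2) (by positivity)
    refine ⟨z • 1 + c α • gapIdem A α, Submodule.mem_span_pair.2 ⟨z, c α, rfl⟩, ?_⟩
    have h1 : ‖L - (z • 1 + c α • gapIdem A α)‖ ≤ ε / 2 :=
      le_of_tendsto ((Tendsto.sub_const hL _).norm) (eventually_norm_sub_gapIdem_le hA α h)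
    rw [dist_eq_norm]
    linarith
  obtain ⟨a, b, rfl⟩ := Submodule.mem_span_pair.1 hLW
  exact ⟨a, b, hL⟩

/-! ### Separability -/

/-- Where all limits are scalar, the coefficients of an approximant are small and can be dropped
together: at each late coordinate at most one of them acts. Finitely many coordinates are then
corrected exactly. -/
theorem isSeparable_of_countable_support (hA : IsLuzinGap A) {B : Set LInftyM2}
    (hB : B ⊆ luzinSet A)
    (hc : {α | ∃ x ∈ B, ∃ a b : ℂ, b ≠ 0 ∧
      Tendsto (fun n => x n) (gapFilter A α) (𝓝 (a • 1 + b • gapIdem A α))}.Countable) :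
    TopologicalSpace.IsSeparable B := by
  classical
  set U := {α | ∃ x ∈ B, ∃ a b : ℂ, b ≠ 0 ∧
      Tendsto (fun n => x n) (gapFilter A α) (𝓝 (a • 1 + b • gapIdem A α))} with hU
  set T : Set LInftyM2 := {1} ∪ (fun α => pElement (A α)) '' U ∪
    ⋃ n : ℕ, Set.range (lp.single (E := fun _ : ℕ => M2) ∞ n) with hT
  have hTsep : TopologicalSpace.IsSeparable T := by
    refine ((Set.countable_singleton _).isSeparable.union (hc.image _).isSeparable).union ?_
    refine TopologicalSpace.IsSeparable.iUnion fun n => ?_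
    exact TopologicalSpace.isSeparable_range (lp.isometry_single n).continuous
  refine (hTsep.span (R := ℂ)).closure.mono fun x hx => ?_
  rw [Metric.mem_closure_iff]
  intro ε hε
  have hp := pBound_nonneg
  -- Chosen so that the approximation error `η` and the dropped term, at most `2 * η * pBound`, add
  -- up to `ε / 2`.
  set η : ℝ := ε / (2 * (1 + 2 * pBound)) with hη
  have hη0 : 0 < η := by positivity
  have hηε : η + 2 * η * pBound < ε := by
    have : η + 2 * η * pBound = ε / 2 := by rw [hη]; field_simp
    linarith
  obtain ⟨z, c, h⟩ := hB hx η hη0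
  have hsmall : ∀ α ∉ U, ‖c α‖ ≤ 2 * η := by
    intro α hα
    obtain ⟨a, b, hab⟩ := exists_tendsto_gapFilter hA α (hB hx)
    have hb : b = 0 := by
      by_contra hb
      exact hα ⟨x, hx, a, b, hb, hab⟩
    have hne := gapFilter_neBot hA α
    have h1 : ‖(a • 1 + b • gapIdem A α) - (z • 1 + c α • gapIdem A α)‖ ≤ η :=
      le_of_tendsto ((Tendsto.sub_const hab _).norm) (eventually_norm_sub_gapIdem_le hA α h)
    -- The diagonal entries of the idempotent are 0 and 1, so comparing them with a scalar limit
    -- isolates `c α`.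
    have h2 := (M2.norm_entry_le _ 0 0).trans h1
    have h3 := (M2.norm_entry_le _ 1 1).trans h1
    simp only [hb, gapIdem, pMatrix, zero_smul, add_zero, Matrix.sub_apply, Matrix.add_apply,
      Matrix.smul_apply, Matrix.one_apply_eq, smul_eq_mul, mul_one, Matrix.of_apply,
      Matrix.cons_val_zero, Matrix.cons_val_one, mul_zero] at h2 h3
    have h4 : c α = (a - z) - (a - (z + c α)) := by ring
    rw [h4]
    exact (norm_sub_le _ _).trans (by linarith)
  set c' := c.filter (· ∈ U) with hc'
  obtain ⟨m₁, hm₁⟩ := eventually_atTop.1 h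
  obtain ⟨m₂, hm₂⟩ := exists_separates hA c.support
  set m := max m₁ m₂
  have hclose : ∀ n, m ≤ n → ‖x n - unitComb A z c' n‖ ≤ η + 2 * η * pBound := by
    intro n hn
    have e1 : x n - unitComb A z c' n =
        (x n - unitComb A z c n) + (comb A c n - comb A c' n) := by
      rw [unitComb_apply, unitComb_apply]
      abel
    rw [e1]
    refine (norm_add_le _ _).trans (add_le_add (hm₁ n ((le_max_left _ _).trans hn)) ?_)
    have hs : c'.support ⊆ c.support := by
      rw [hc', Finsupp.support_filter]
      exact Finset.filter_subset _ _
    by_cases hex : ∃ α ∈ c.support, n ∈ A α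
    · obtain ⟨α, hα, hnα⟩ := hex
      have hn₂ := (le_max_right _ _).trans hn
      rw [comb_apply_of_mem hm₂ subset_rfl hn₂ hα hnα, comb_apply_of_mem hm₂ hs hn₂ hα hnα,
        ← sub_smul, norm_smul]
      gcongr
      · rw [hc', Finsupp.filter_apply]
        split_ifs with hαU
        · rw [sub_self, norm_zero]
          positivity
        · rw [sub_zero]
          exact hsmall α hαU
      · exact norm_pMatrix_le (abs_cantorPoint_le _)
    · push Not at hex
      rw [comb_apply_of_notMem subset_rfl hex, comb_apply_of_notMem hs hex, sub_self, norm_zero]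
      positivity
  refine ⟨unitComb A z c' + ∑ n ∈ Finset.range m, lp.single ∞ n (x n - unitComb A z c' n), ?_, ?_⟩
  · have hTs := Submodule.subset_span (R := ℂ) (s := T)
    refine Submodule.add_mem _ ?_ (Submodule.sum_mem _ fun n _ => hTs ?_)
    · rw [unitComb, comb, Finsupp.linearCombination_apply, Finsupp.sum]
      refine Submodule.add_mem _ (Submodule.smul_mem _ _ (hTs (Or.inl (Or.inl rfl))))
        (Submodule.sum_mem _ fun α hα => Submodule.smul_mem _ _ (hTs (Or.inl (Or.inr ?_))))
      rw [hc', Finsupp.support_filter, Finset.mem_filter] at hα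
      exact ⟨α, hα.2, rfl⟩
    · exact Or.inr (Set.mem_iUnion.2 ⟨n, Set.mem_range_self _⟩)
  · rw [dist_eq_norm]
    refine lt_of_le_of_lt ?_ hηε
    refine lp.norm_le_of_forall_le (by positivity) fun k => ?_
    rw [lp.coeFn_sub, Pi.sub_apply, lp.coeFn_add, Pi.add_apply, lp.coeFn_sum, Finset.sum_apply]
    rcases lt_or_ge k m with hk | hk
    · rw [Finset.sum_eq_single_of_mem k (Finset.mem_range.2 hk), lp.single_apply_self,
        add_sub_cancel, sub_self, norm_zero]
      · positivity
      · intro n _ hn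
        exact lp.single_apply_ne _ _ _ hn.symm
    · rw [Finset.sum_eq_zero, add_zero]
      · exact hclose k hk
      · intro n hn
        have := Finset.mem_range.1 hn
        exact lp.single_apply_ne _ _ _ (by omega)

theorem not_isSeparable_luzinSet (hA : IsLuzinGap A) :
    ¬ TopologicalSpace.IsSeparable (luzinSet A) := by
  rintro ⟨C, hC, hCA⟩
  have hp : ∀ α, pElement (A α) ∈ luzinSet A := by
    intro α
    have := unitComb_mem_luzinSet (A := A) 0 (Finsupp.single α 1)
    rwa [unitComb, zero_smul, zero_add, comb_single, one_smul] at this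
  have hsep : ∀ α β, α ≠ β → 1 ≤ dist (pElement (A α)) (pElement (A β)) := by
    intro α β hne
    obtain ⟨n, hn, hn'⟩ := ((hA.infinite α).sdiff (hA.almost_disjoint α β hne)).nonempty
    have hnβ : n ∉ A β := fun h => hn' ⟨hn, h⟩
    rw [dist_eq_norm]
    refine le_trans ?_ (LInftyM2.norm_apply_le _ n)
    rw [lp.coeFn_sub, Pi.sub_apply, pElement_of_mem hn, pElement_of_notMem hnβ, sub_zero]
    exact one_le_norm_pMatrix _
  have h : ∀ α, ∃ y ∈ C, dist (pElement (A α)) y < 1 / 2 := fun α =>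
    Metric.mem_closure_iff.1 (hCA (hp α)) _ (by norm_num)
  choose f hfC hf using h
  have hinj : Function.Injective f := by
    intro α β hαβ
    by_contra hne
    have h1 := dist_triangle_right (pElement (A α)) (pElement (A β)) (f α)
    have h2 := hf α
    have h3 := hf β
    rw [← hαβ] at h3
    linarith [hsep α β hne]
  refine OmegaOne.not_countable_univ ((hC.preimage_of_injOn hinj.injOn).mono fun α _ => hfC α)

end

/-! ### Subalgebras that are isomorphic to C⋆-algebras -/

/-- Discarding the points that lie in a rational interval with countable preimage in `S` removes
only countably many. Two remaining points have disjoint rational neighbourhoods with a gap between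
them, both with uncountable preimage. -/
theorem exists_uncountable_separated {ι : Type*} {S : Set ι} (hS : ¬ S.Countable) {f : ι → ℝ}
    (hf : Function.Injective f) : ∃ δ > 0, ∃ U ⊆ S, ∃ V ⊆ S, ¬ U.Countable ∧ ¬ V.Countable ∧
      ∀ α ∈ U, ∀ β ∈ V, δ ≤ f α - f β := by
  let I : ℚ × ℚ → Set ι := fun q => {β ∈ S | (q.1 : ℝ) < f β ∧ f β < q.2}
  set C : Set ι := ⋃ q ∈ {q : ℚ × ℚ | (I q).Countable}, I q with hCdef
  have hC : C.Countable := Set.Countable.biUnion (Set.to_countable _) fun q hq => hq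
  have hinf : (S \ C).Infinite := fun h => hS
    ((h.countable.union hC).mono fun x hx => by by_cases hxC : x ∈ C <;> simp [hx, hxC])
  have hI : ∀ α ∈ S \ C, ∀ q : ℚ × ℚ, (q.1 : ℝ) < f α → f α < q.2 → ¬ (I q).Countable := by
    intro α hα q h1 h2 hq
    exact hα.2 (Set.mem_biUnion (show q ∈ {q : ℚ × ℚ | (I q).Countable} from hq) ⟨hα.1, h1, h2⟩)
  have main : ∀ α ∈ S \ C, ∀ β ∈ S \ C, f β < f α → ∃ δ > 0, ∃ U ⊆ S, ∃ V ⊆ S,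
      ¬ U.Countable ∧ ¬ V.Countable ∧ ∀ α ∈ U, ∀ β ∈ V, δ ≤ f α - f β := by
    intro α hα β hβ hlt
    obtain ⟨q, hq1, hq2⟩ := exists_rat_btwn hlt
    obtain ⟨r, hr1, hr2⟩ := exists_rat_btwn hq2
    obtain ⟨s, hs⟩ := exists_rat_lt (f β)
    obtain ⟨t, ht⟩ := exists_rat_gt (f α)
    refine ⟨(r : ℝ) - q, by linarith, I (r, t), fun x hx => hx.1, I (s, q), fun x hx => hx.1,
      hI α hα _ hr2 ht, hI β hβ _ hs hq1, fun x hx y hy => ?_⟩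
    have h1 := hx.2.1
    have h2 := hy.2.2
    dsimp only at h1 h2
    linarith
  obtain ⟨α, hα, β, hβ, hne⟩ := hinf.nontrivial
  rcases lt_or_gt_of_ne (hf.ne hne) with h | h
  · exact main β hβ α hα h
  · exact main α hα β hβ h

/-- Evaluation of bounded sequences at `n`. -/
noncomputable def LInftyM2.coord (n : ℕ) : LInftyM2 →ₙₐ[ℂ] M2 where
  toFun x := x n
  map_smul' _ _ := rfl
  map_zero' := rfl
  map_add' _ _ := rfl
  map_mul' _ _ := rfl

/-- The square of an element near an element of square zero is small. -/
theorem norm_mul_self_le_of_mul_self_eq_zero {R : Type*} [NonUnitalNormedRing R] {y z : R}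
    {c ε : ℝ} (hz : z * z = 0) (hc : ‖z‖ ≤ c) (hyz : ‖y - z‖ ≤ ε) :
    ‖y * y‖ ≤ ε * (2 * c + ε) := by
  have hε : 0 ≤ ε := (norm_nonneg _).trans hyz
  have hy : ‖y‖ ≤ c + ε := by
    have := norm_sub_norm_le y z
    linarith
  have h : y * y = (y - z) * y + z * (y - z) := by
    rw [sub_mul, mul_sub, hz]
    abel
  have h1 : ‖(y - z) * y‖ ≤ ε * (c + ε) := (norm_mul_le _ _).trans (by gcongr)
  have h2 : ‖z * (y - z)‖ ≤ c * ε :=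
    (norm_mul_le _ _).trans (mul_le_mul hc hyz (norm_nonneg _) ((norm_nonneg _).trans hc))
  rw [h]
  refine (norm_add_le _ _).trans ?_
  linarith

theorem nMatrix_ne_zero : nMatrix ≠ 0 := by
  intro h
  have := congrFun (congrFun h 1) 0
  simp [nMatrix] at this

section

variable {A : OmegaOne → Set ℕ} {D : Type*} [NonUnitalCStarAlgebra D]

theorem cantorPoint_comp_injective (hA : IsLuzinGap A) :
    Function.Injective fun α => cantorPoint (A α) := by
  intro α β h
  by_contra hne
  have h1 : A α = A β := cantorPoint_injective h
  have h2 := hA.almost_disjoint α β hne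
  rw [← h1, Set.inter_self] at h2
  exact hA.infinite α h2

theorem norm_coord_sq_le (j : D →ₙₐ[ℂ] LInftyM2) {K : ℝ} (hK : ∀ d, ‖j d‖ ≤ K * ‖d‖) (d : D)
    (n : ℕ) : ‖j d n‖ ^ 2 ≤ 2 * K ^ 2 * ‖j (star d * d) n‖ :=
  norm_map_sq_le ((LInftyM2.coord n).comp j)
    (fun d => (LInftyM2.norm_apply_le (j d) n).trans (hK d)) d

theorem tendsto_map_mul (j : D →ₙₐ[ℂ] LInftyM2) {l : Filter ℕ} {d e : D} {P Q : M2}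
    (hd : Tendsto (fun n => j d n) l (𝓝 P)) (he : Tendsto (fun n => j e n) l (𝓝 Q)) :
    Tendsto (fun n => j (d * e) n) l (𝓝 (P * Q)) := by
  refine (hd.mul he).congr fun n => ?_
  rw [map_mul, lp.infty_coeFn_mul, Pi.mul_apply]

theorem tendsto_map_sub (j : D →ₙₐ[ℂ] LInftyM2) {l : Filter ℕ} {d e : D} {P Q : M2}
    (hd : Tendsto (fun n => j d n) l (𝓝 P)) (he : Tendsto (fun n => j e n) l (𝓝 Q)) :
    Tendsto (fun n => j (d - e) n) l (𝓝 (P - Q)) := by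
  refine (hd.sub he).congr fun n => ?_
  rw [map_sub, lp.coeFn_sub, Pi.sub_apply]

theorem tendsto_map_smul (j : D →ₙₐ[ℂ] LInftyM2) {l : Filter ℕ} {d : D} {P : M2} (r : ℂ)
    (hd : Tendsto (fun n => j d n) l (𝓝 P)) :
    Tendsto (fun n => j (r • d) n) l (𝓝 (r • P)) := by
  refine (hd.const_smul r).congr fun n => ?_
  rw [map_smul, lp.coeFn_smul, Pi.smul_apply]

/-- No unit is available in `D`, so the idempotent must come from polynomials without constant term.
If `a + b ≠ 0`, then `x² - a x = b (a + b) p` for `x = a + b p`; otherwise `x = a (1 - p)`. -/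
theorem exists_tendsto_idempotent (j : D →ₙₐ[ℂ] LInftyM2) {α : OmegaOne} {d : D} {a b : ℂ}
    (hb : b ≠ 0)
    (hd : Tendsto (fun n => j d n) (gapFilter A α) (𝓝 (a • 1 + b • gapIdem A α))) :
    ∃ d', Tendsto (fun n => j d' n) (gapFilter A α) (𝓝 (gapIdem A α)) ∨
      Tendsto (fun n => j d' n) (gapFilter A α) (𝓝 (1 - gapIdem A α)) := by
  by_cases hab : a + b = 0
  · have ha : a = -b := eq_neg_of_add_eq_zero_left hab
    refine ⟨a⁻¹ • d, Or.inr ?_⟩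
    convert tendsto_map_smul j a⁻¹ hd using 2
    have ha0 : a ≠ 0 := by rw [ha]; exact neg_ne_zero.2 hb
    have hb' : a⁻¹ * b = -1 := by rw [ha]; field_simp
    rw [smul_add, smul_smul, smul_smul, inv_mul_cancel₀ ha0, hb', one_smul, neg_smul, one_smul,
      sub_eq_add_neg]
  · refine ⟨(b * (a + b))⁻¹ • (d * d - a • d), Or.inl ?_⟩
    convert tendsto_map_smul j (b * (a + b))⁻¹
      (tendsto_map_sub j (tendsto_map_mul j hd hd) (tendsto_map_smul j a hd)) using 2
    have h : (a • 1 + b • gapIdem A α) * (a • 1 + b • gapIdem A α) -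
        a • (a • 1 + b • gapIdem A α) = (b * (a + b)) • gapIdem A α := by
      simp only [add_mul, mul_add, smul_mul_smul_comm, mul_one, one_mul, gapIdem_mul_self,
        smul_add, smul_smul, add_smul]
      rw [mul_comm b a]
      abel
    rw [h, smul_smul, inv_mul_cancel₀ (mul_ne_zero hb hab), one_smul]

theorem eq_zero_of_tendsto_star_mul_self (j : D →ₙₐ[ℂ] LInftyM2) {K : ℝ}
    (hK : ∀ d, ‖j d‖ ≤ K * ‖d‖) {l : Filter ℕ} [l.NeBot] {d : D} {P : M2}
    (hd : Tendsto (fun n => j d n) l (𝓝 P))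
    (hd' : Tendsto (fun n => j (star d * d) n) l (𝓝 0)) : P = 0 := by
  have h := le_of_tendsto_of_tendsto' (hd.norm.pow 2) (hd'.norm.const_mul (2 * K ^ 2))
    fun n => norm_coord_sq_le j hK d n
  rw [norm_zero, mul_zero] at h
  have : ‖P‖ ^ 2 = 0 := le_antisymm h (sq_nonneg _)
  exact norm_eq_zero.1 (pow_eq_zero_iff two_ne_zero |>.1 this)

/-- An idempotent limit that commutes with the limit of the adjoint is the limit of a positive
element. -/
theorem tendsto_star_mul_self (j : D →ₙₐ[ℂ] LInftyM2) {K : ℝ}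
    (hK : ∀ d, ‖j d‖ ≤ K * ‖d‖) {l : Filter ℕ} [l.NeBot] {d : D} {P Q : M2} (hP : P * P = P)
    (hPQ : Q * P = P * Q) (hd : Tendsto (fun n => j d n) l (𝓝 P))
    (hd' : Tendsto (fun n => j (star d) n) l (𝓝 Q)) :
    Tendsto (fun n => j (star d * d) n) l (𝓝 P) := by
  have h1 := tendsto_map_mul j hd' hd
  have h2 := tendsto_map_sub j hd h1
  have h3 : Tendsto (fun n => j (star (d - star d * d)) n) l (𝓝 (Q - Q * P)) := by
    rw [star_sub, star_mul, star_star]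
    exact tendsto_map_sub j hd' h1
  have h4 := tendsto_map_mul j h3 h2
  -- For `y = d - d⋆ d` this is the limit of `y⋆ y`, so the C⋆-inequality gives `P = Q P`.
  have h5 : (Q - Q * P) * (P - Q * P) = 0 := by
    have e1 : Q * P * (Q * P) = Q * (Q * P) := by
      rw [hPQ, mul_assoc, ← mul_assoc Q P Q, hPQ, mul_assoc P Q Q, ← mul_assoc P P, hP]
    have e2 : Q * P * P = Q * P := by rw [mul_assoc, hP]
    rw [sub_mul, mul_sub, mul_sub, e1, e2]
    abel
  rw [h5] at h4
  have h6 := eq_zero_of_tendsto_star_mul_self j hK h2 h4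
  rwa [← sub_eq_zero.1 h6] at h1

theorem exists_selfAdjoint_tendsto (hA : IsLuzinGap A) (j : D →ₙₐ[ℂ] LInftyM2) {K : ℝ}
    (hK : ∀ d, ‖j d‖ ≤ K * ‖d‖) (hj : ∀ d, j d ∈ luzinSet A) {α : OmegaOne} {d : D} {a b : ℂ}
    (hb : b ≠ 0)
    (hd : Tendsto (fun n => j d n) (gapFilter A α) (𝓝 (a • 1 + b • gapIdem A α))) :
    ∃ d', IsSelfAdjoint d' ∧ (Tendsto (fun n => j d' n) (gapFilter A α) (𝓝 (gapIdem A α)) ∨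
      Tendsto (fun n => j d' n) (gapFilter A α) (𝓝 (1 - gapIdem A α))) := by
  have hne := gapFilter_neBot hA α
  obtain ⟨e, he⟩ := exists_tendsto_idempotent j hb hd
  obtain ⟨z, w, hzw⟩ := exists_tendsto_gapFilter hA α (hj (star e))
  -- The limit of the adjoint also lies in the span of 1 and the idempotent, hence commutes with it.
  have hcomm : Commute (z • 1 + w • gapIdem A α) (gapIdem A α) :=
    ((Commute.one_left _).smul_left z).add_left ((Commute.refl _).smul_left w)
  refine ⟨star e * e, IsSelfAdjoint.star_mul_self e, he.imp (fun h => ?_) fun h => ?_⟩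
  · exact tendsto_star_mul_self j hK (gapIdem_mul_self α) hcomm h hzw
  · refine tendsto_star_mul_self j hK ?_ ((Commute.one_right _).sub_right hcomm) h hzw
    rw [sub_mul, mul_sub, mul_sub, gapIdem_mul_self]
    simp

/-- Only countably many members of a Luzin gap admit self-adjoint elements with limit `P α`, if the
differences of the `P α` are nilpotent and proportional to the differences of the
`cantorPoint (A α)`. -/
theorem countable_of_selfAdjoint_tendsto (hA : IsLuzinGap A) (j : D →ₙₐ[ℂ] LInftyM2) {K : ℝ}
    (hK : ∀ d, ‖j d‖ ≤ K * ‖d‖) (P : OmegaOne → M2) {s : ℂ} (hs : ‖s‖ = 1)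
    (hP : ∀ α β, P α - P β =
      (s * ((cantorPoint (A α) - cantorPoint (A β) : ℝ) : ℂ)) • nMatrix) :
    {α | ∃ d, IsSelfAdjoint d ∧ Tendsto (fun n => j d n) (gapFilter A α) (𝓝 (P α))}.Countable := by
  set S := {α | ∃ d, IsSelfAdjoint d ∧ Tendsto (fun n => j d n) (gapFilter A α) (𝓝 (P α))}
  by_contra hS
  obtain ⟨δ, hδ, U, hUS, V, hVS, hU, hV, hUV⟩ :=
    exists_uncountable_separated hS (cantorPoint_comp_injective hA)
  have hd : ∀ α, ∃ d, α ∈ S →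
      IsSelfAdjoint d ∧ Tendsto (fun n => j d n) (gapFilter A α) (𝓝 (P α)) := by
    intro α
    by_cases h : α ∈ S
    · obtain ⟨d, hd⟩ := h
      exact ⟨d, fun _ => hd⟩
    · exact ⟨0, fun h' => (h h').elim⟩
  choose d hd using hd
  set ν := ‖nMatrix‖ with hν
  have hν0 : 0 < ν := norm_pos_iff.2 nMatrix_ne_zero
  -- Within `2ε` of the nilpotent `Z`, the value `Y` of a self-adjoint element has `‖Y‖ ≥ δν - 2ε`
  -- but `‖Y * Y‖ = O(ε)`. The C⋆-inequality bounds `‖Y‖²` by a constant times `‖Y * Y‖`; since `δ`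
  -- is independent of `ε`, letting `ε → 0` is contradictory.
  have key : ∀ ε > 0, 2 * ε < δ * ν →
      (δ * ν - 2 * ε) ^ 2 ≤ 2 * K ^ 2 * (2 * ε * (2 * (2 * ν) + 2 * ε)) := by
    intro ε hε hεδ
    have hm : ∀ α, ∃ m, α ∈ S → ∀ n, m ≤ n → n ∈ A α → ‖j (d α) n - P α‖ ≤ ε := by
      intro α
      by_cases h : α ∈ S
      · have h1 := (hd α h).2.eventually (Metric.closedBall_mem_nhds (P α) hε)
        obtain ⟨m, hm⟩ := eventually_gapFilter.1 h1
        refine ⟨m, fun _ n hn hnα => ?_⟩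
        rw [← dist_eq_norm]
        exact hm n hn hnα
      · exact ⟨0, fun h' => (h h').elim⟩
    choose m hm using hm
    obtain ⟨α, hα, β, hβ, n, hn1, hn2, hnα, hnβ⟩ := hA.exists_mem_inter hU hV m
    have h1 := hm α (hUS hα) n hn1 hnα
    have h2 := hm β (hVS hβ) n hn2 hnβ
    set e := d α - d β
    have he : star e * e = e * e := by
      rw [((hd α (hUS hα)).1.sub (hd β (hVS hβ)).1).star_eq]
    set Z := P α - P β with hZ
    set Y : M2 := j e n with hY
    have hYZ : ‖Y - Z‖ ≤ 2 * ε := by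
      have : Y - Z = (j (d α) n - P α) - (j (d β) n - P β) := by
        rw [hY, hZ, map_sub, lp.coeFn_sub, Pi.sub_apply]
        abel
      rw [this]
      exact (norm_sub_le _ _).trans (by linarith)
    have hZZ : Z * Z = 0 := by
      rw [hZ, hP, smul_mul_smul_comm, nMatrix_mul_self, smul_zero]
    have hZn : ‖Z‖ = |cantorPoint (A α) - cantorPoint (A β)| * ν := by
      rw [hZ, hP, norm_smul, norm_mul, hs, one_mul, Complex.norm_real, Real.norm_eq_abs]
    have hZlow : δ * ν ≤ ‖Z‖ := by
      rw [hZn]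
      gcongr
      exact (hUV α hα β hβ).trans (le_abs_self _)
    have hZup : ‖Z‖ ≤ 2 * ν := by
      rw [hZn]
      gcongr
      have := abs_cantorPoint_le (A α)
      have := abs_cantorPoint_le (A β)
      exact (abs_sub _ _).trans (by linarith)
    have hYlow : δ * ν - 2 * ε ≤ ‖Y‖ := by
      have := norm_sub_norm_le Z Y
      rw [norm_sub_rev Z Y] at this
      linarith
    have hYY := norm_mul_self_le_of_mul_self_eq_zero hZZ hZup hYZ
    have hfin := norm_coord_sq_le j hK e n
    rw [he, map_mul, lp.infty_coeFn_mul, Pi.mul_apply] at hfin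
    calc (δ * ν - 2 * ε) ^ 2 ≤ ‖Y‖ ^ 2 := by
          have : 0 ≤ δ * ν - 2 * ε := by linarith
          gcongr
      _ ≤ 2 * K ^ 2 * ‖Y * Y‖ := hfin
      _ ≤ _ := by gcongr
  have hlim1 : Tendsto (fun ε : ℝ => (δ * ν - 2 * ε) ^ 2) (𝓝[>] 0) (𝓝 ((δ * ν - 2 * 0) ^ 2)) :=
    ((by fun_prop : Continuous fun ε : ℝ => (δ * ν - 2 * ε) ^ 2).tendsto 0).mono_left
      nhdsWithin_le_nhds
  have hlim2 : Tendsto (fun ε : ℝ => 2 * K ^ 2 * (2 * ε * (2 * (2 * ν) + 2 * ε))) (𝓝[>] 0)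
      (𝓝 (2 * K ^ 2 * (2 * 0 * (2 * (2 * ν) + 2 * 0)))) :=
    ((by fun_prop : Continuous fun ε : ℝ => 2 * K ^ 2 * (2 * ε * (2 * (2 * ν) + 2 * ε))).tendsto
      0).mono_left nhdsWithin_le_nhds
  have hδν : 0 < δ * ν := by positivity
  have hle := le_of_tendsto_of_tendsto hlim1 hlim2 (by
    filter_upwards [self_mem_nhdsWithin, nhdsWithin_le_nhds (gt_mem_nhds (half_pos hδν))]
      with ε h1 h2
    exact key ε h1 (by linarith))
  have : 0 < (δ * ν) ^ 2 := by positivity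
  simp only [mul_zero, sub_zero, zero_mul] at hle
  linarith

theorem isSeparable_range_of_cstar (hA : IsLuzinGap A) (j : D →ₙₐ[ℂ] LInftyM2) {K : ℝ}
    (hK : ∀ d, ‖j d‖ ≤ K * ‖d‖) (hj : ∀ d, j d ∈ luzinSet A) :
    TopologicalSpace.IsSeparable (Set.range j) := by
  refine isSeparable_of_countable_support hA (Set.range_subset_iff.2 hj) ?_
  have h1 := countable_of_selfAdjoint_tendsto hA j hK (fun α => gapIdem A α) (s := 1) norm_one
    fun α β => by rw [gapIdem, gapIdem, pMatrix_sub, one_mul]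
  -- Passing to complements only reverses the sign of the differences, whence `s = -1`.
  have h2 := countable_of_selfAdjoint_tendsto hA j hK (fun α => 1 - gapIdem A α) (s := -1)
    (by simp) fun α β => by
      rw [sub_sub_sub_cancel_left, gapIdem, gapIdem, pMatrix_sub, ← neg_sub, Complex.ofReal_neg,
        neg_one_mul]
  refine (h1.union h2).mono ?_
  rintro α ⟨_, ⟨d, rfl⟩, a, b, hb, hd⟩
  obtain ⟨d', hsa, h | h⟩ := exists_selfAdjoint_tendsto hA j hK hj hb hd
  · exact Or.inl ⟨d', hsa, h⟩
  · exact Or.inr ⟨d', hsa, h⟩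

theorem isSeparable_range_of_isIsomorphicToCStarAlgebra (hA : IsLuzinGap A) {B : Type}
    [NonUnitalNormedRing B] [NormedSpace ℂ B] (i : B →ₗ[ℂ] LInftyM2)
    (hmul : ∀ x y, i (x * y) = i x * i y) (hnorm : ∀ x, ‖i x‖ = ‖x‖) (hi : ∀ x, i x ∈ luzinSet A)
    (h : IsIsomorphicToCStarAlgebra B) : TopologicalSpace.IsSeparable (Set.range i) := by
  obtain ⟨D, _, e, he⟩ := h
  have hmul' : ∀ c d : D, e.symm (c * d) = e.symm c * e.symm d := fun c d => by
    apply e.injective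
    rw [he, e.apply_symm_apply, e.apply_symm_apply, e.apply_symm_apply]
  let j : D →ₙₐ[ℂ] LInftyM2 :=
    { toFun := fun d => i (e.symm d)
      map_smul' := fun c d => by rw [map_smul, map_smul]; rfl
      map_zero' := by rw [map_zero, map_zero]
      map_add' := fun c d => by rw [map_add, map_add]
      map_mul' := fun c d => by rw [hmul', hmul] }
  have hsep := isSeparable_range_of_cstar hA j (K := ‖(e.symm : D →L[ℂ] B)‖)
    (fun d => (hnorm _).trans_le ((e.symm : D →L[ℂ] B).le_opNorm d)) fun d => hi (e.symm d)
  refine hsep.mono ?_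
  rintro _ ⟨x, rfl⟩
  exact ⟨e x, congrArg i (e.symm_apply_apply x)⟩

theorem separableSpace_of_isIsomorphicToCStarAlgebra (hA : IsLuzinGap A)
    (B : NonUnitalSubalgebra ℂ LInftyM2) (hB : (B : Set LInftyM2) ⊆ luzinSet A)
    (h : IsIsomorphicToCStarAlgebra B) : TopologicalSpace.SeparableSpace B := by
  have hsep := isSeparable_range_of_isIsomorphicToCStarAlgebra hA B.toSubmodule.subtype
    (fun _ _ => rfl) (fun _ => rfl) (fun x => hB x.2) h
  exact (hsep.mono fun x hx => ⟨⟨x, hx⟩, rfl⟩ :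
    TopologicalSpace.IsSeparable (B : Set LInftyM2)).separableSpace

end

theorem theorem1 :
    (∃ A : OmegaOne → Set ℕ, IsLuzinGap A) ∧
    ∀ A : OmegaOne → Set ℕ, IsLuzinGap A →
      ∃ π : Multiplicative (OmegaOne →₀ ZMod 2) → CoronaM2,
        IsUniformlyBoundedRep π ∧
        (∀ α, π (Multiplicative.ofAdd (Finsupp.single α 1)) = coronaQ (wElement (A α))) ∧
        ∃ 𝒜 : Subalgebra ℂ LInftyM2,
          (𝒜 : Set LInftyM2) =
            coronaQ ⁻¹' closure (Submodule.span ℂ (Set.range π) : Set CoronaM2) ∧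
          IsOperatorAlgebra 𝒜 ∧
          IsAmenableBanachAlgebra 𝒜 ∧
          ¬ TopologicalSpace.SeparableSpace 𝒜 ∧
          ∀ ℬ : NonUnitalSubalgebra ℂ LInftyM2, (ℬ : Set LInftyM2) ⊆ 𝒜 →
            ¬ TopologicalSpace.SeparableSpace ℬ → ¬ IsIsomorphicToCStarAlgebra ℬ := by
  refine ⟨exists_isLuzinGap, fun A hA => ⟨luzinRep A, isUniformlyBoundedRep_luzinRep hA,
    luzinRep_single, luzinAlgebra hA, luzinSet_eq_preimage,
    isOperatorAlgebra_of_isClosed _ isClosed_luzinSet, isAmenable_luzinAlgebra hA, fun h => ?_,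
    fun ℬ hℬ hsep h => hsep (separableSpace_of_isIsomorphicToCStarAlgebra hA ℬ hℬ h)⟩⟩
  exact not_isSeparable_luzinSet hA
    (TopologicalSpace.IsSeparable.of_subtype (luzinAlgebra hA : Set LInftyM2))
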